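/- Let $D\ge 2$ and let $\sigma$ be a density matrix on $\mathbb C^D$, with orthonormal eigenbasis $|1\rangle,\dots,|D\rangle$ and eigenvalues $\lambda_1,\dots,\lambda_D$. A POVM is a finite family $E=(E_i)$ of positive semidefinite matrices with $\sum_i E_i=\mathbb 1$. For a state $\rho$ put $p_i=\mathrm{Tr}[E_i\sigma]$, $q_i=\mathrm{Tr}[E_i\rho]$ and $\chi^2(p,q)=\sum_i (q_i-p_i)^2/p_i\in[0,\infty]$ (with $0/0=0$ and $a/0=\infty$ for $a>0$). Let $\|\cdot\|_F$ be the Frobenius norm and, for $\varepsilon>0$, $$\xi_\varepsilon(\sigma)=\frac1{\varepsilon^2}\max_{E}\ \min_{\rho:\ \|\rho-\sigma\|_F\ge\varepsilon}\chi^2(p,q),\qquad \xi(\sigma)=\max_{E}\ \min_{X}\ \sum_i\frac{\mathrm{Tr}[E_iX]^2}{\mathrm{Tr}[E_i\sigma]},$$ where $\rho$ runs over density matrices and $X$ over the traceless Hermitian matrices with $\|X\|_F=1$ (the directions $X=(\rho-\sigma)/\varepsilon$). 1. All maxima and minima in $\xi(\sigma)$ exist and $\xi(\sigma)=\dfrac1{1+\mu}$,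 where $\mu$ is the largest eigenvalue of $S=\mathrm{diag}(\lambda)-\lambda\lambda^T$. If $\sigma$ is not pure and $\varepsilon>0$ is at most the smallest nonzero eigenvalue of $\sigma$, then the maxima and minima in $\xi_\varepsilon(\sigma)$ exist and $\xi_\varepsilon(\sigma)=\xi(\sigma)=\dfrac1{1+\mu}$. If $\sigma$ is pure, then $\xi_{\varepsilon}(\sigma')\to 1$ as $\sigma'\to\sigma$ through density matrices of full rank, uniformly in $\varepsilon>0$ at most the smallest eigenvalue of $\sigma'$. 2. $\frac23\le\xi(\sigma)\le1$. Moreover $\xi(\sigma)=1$ if and only if $\sigma$ is pure, and $\xi(\sigma)=\frac23$ if and only if two of the eigenvalues equal $\frac12$ and all others are $0$. 3. Let $\sigma$ be not pure, $\xi=\xi(\sigma)$, and consider phase states $|\chi_j\rangle=D^{-1/2}\sum_k e^{i\theta_j^k}|k\rangle$, $1\le j\le m$, which are invariant under the unitaries $U$ diagonal in the basis $|k\rangle$, in the sense that the map $T(X)=\sum_j\langle\chi_j|X|\chi_j\rangle\,|\chi_j\rangle\langle\chi_j|$ satisfies $T(UXU^\dagger)=U\,T(X)\,U^\dagger$ for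 all $X$ and all such $U$. There are such phase states and a real $c$ with $\sum_j c\,|\chi_j\rangle\langle\chi_j|=\xi\,\mathbb 1$; and for every such choice the matrices $(1-\xi)|i\rangle\langle i|$, $1\le i\le D$, together with $c\,|\chi_j\rangle\langle\chi_j|$, $1\le j\le m$, form an informationally complete POVM that attains the maximum in $\xi(\sigma)$, and the maximum in $\xi_\varepsilon(\sigma)$ for every $\varepsilon>0$ that is at most the smallest nonzero eigenvalue of $\sigma$. -/

import Mathlib

open scoped ENNReal ComplexOrder

noncomputable section

namespace QChiSq

/-- Density matrices (states) on `ℂ^D`. -/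
def IsState {D : ℕ} (σ : Matrix (Fin D) (Fin D) ℂ) : Prop :=
  σ.PosSemidef ∧ σ.trace = 1

/-- Frobenius norm `√(Tr[X† X])`. -/
def frobNorm {D : ℕ} (X : Matrix (Fin D) (Fin D) ℂ) : ℝ :=
  Real.sqrt (X.conjTranspose * X).trace.re

/-- The rank one operator `|ψ⟩⟨ψ|`. -/
def proj {D : ℕ} (ψ : EuclideanSpace ℂ (Fin D)) : Matrix (Fin D) (Fin D) ℂ :=
  Matrix.vecMulVec ψ.ofLp (star ψ.ofLp)

/-- Pure states: `σ = |ψ⟩⟨ψ|` with `ψ` a unit vector. -/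
def IsPure {D : ℕ} (σ : Matrix (Fin D) (Fin D) ℂ) : Prop :=
  ∃ ψ : EuclideanSpace ℂ (Fin D), ‖ψ‖ = 1 ∧ σ = proj ψ

/-- A POVM with outcomes in a finite set `ι`. -/
def IsPOVM {D : ℕ} {ι : Type*} [Fintype ι] (E : ι → Matrix (Fin D) (Fin D) ℂ) : Prop :=
  (∀ i, (E i).PosSemidef) ∧ ∑ i, E i = 1

/-- Informational completeness: the outcome traces determine the operator. -/
def IsInfoComplete {D : ℕ} {ι : Type*} (E : ι → Matrix (Fin D) (Fin D) ℂ) : Prop :=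
  ∀ X : Matrix (Fin D) (Fin D) ℂ, (∀ i, (E i * X).trace = 0) → X = 0

/-- Born's rule `i ↦ Tr[E_i ρ]` (a real number for Hermitian `E_i` and `ρ`). -/
def born {D : ℕ} {ι : Type*} (E : ι → Matrix (Fin D) (Fin D) ℂ)
    (ρ : Matrix (Fin D) (Fin D) ℂ) (i : ι) : ℝ :=
  (E i * ρ).trace.re

/-- The classical divergence `χ²(p,q) = ∑ (q_i - p_i)² / p_i`, with values in `[0,∞]`;
in `ℝ≥0∞` one has `0 / 0 = 0` and `a / 0 = ∞` for `a ≠ 0`. -/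
def chiSq {ι : Type*} [Fintype ι] (p q : ι → ℝ) : ℝ≥0∞ :=
  ∑ i, ENNReal.ofReal ((q i - p i) ^ 2) / ENNReal.ofReal (p i)

/-- The states at Frobenius distance at least `ε` from `σ`. -/
def alternatives {D : ℕ} (σ : Matrix (Fin D) (Fin D) ℂ) (ε : ℝ) :
    Set (Matrix (Fin D) (Fin D) ℂ) :=
  {ρ | IsState ρ ∧ ε ≤ frobNorm (ρ - σ)}

/-- Rate of the POVM `E`: `ε⁻² min_{‖ρ - σ‖ ≥ ε} χ²(p,q)`. -/
def povmRate {D : ℕ} {ι : Type*} [Fintype ι] (σ : Matrix (Fin D) (Fin D) ℂ) (ε : ℝ)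
    (E : ι → Matrix (Fin D) (Fin D) ℂ) : ℝ≥0∞ :=
  (⨅ ρ ∈ alternatives σ ε, chiSq (born E σ) (born E ρ)) / ENNReal.ofReal (ε ^ 2)

/-- The divergence rate `ε⁻² max_E min_{‖ρ - σ‖ ≥ ε} χ²(p,q)`, over all finite POVMs. -/
def divergenceRate {D : ℕ} (σ : Matrix (Fin D) (Fin D) ℂ) (ε : ℝ) : ℝ≥0∞ :=
  ⨆ (r : ℕ) (E : Fin r → Matrix (Fin D) (Fin D) ℂ) (_ : IsPOVM E), povmRate σ ε E

/-- The directions `X = (ρ - σ)/ε`: traceless Hermitian, of Frobenius norm one. -/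
def directions (D : ℕ) : Set (Matrix (Fin D) (Fin D) ℂ) :=
  {X | X.IsHermitian ∧ X.trace = 0 ∧ frobNorm X = 1}

/-- `∑_i Tr[E_i X]² / Tr[E_i σ]`. -/
def chiForm {D : ℕ} {ι : Type*} [Fintype ι] (σ : Matrix (Fin D) (Fin D) ℂ)
    (E : ι → Matrix (Fin D) (Fin D) ℂ) (X : Matrix (Fin D) (Fin D) ℂ) : ℝ≥0∞ :=
  ∑ i, ENNReal.ofReal (born E X i ^ 2) / ENNReal.ofReal (born E σ i)

/-- Directional rate of the POVM `E`: `min_X ∑_i Tr[E_i X]² / Tr[E_i σ]`. -/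
def povmDirRate {D : ℕ} {ι : Type*} [Fintype ι] (σ : Matrix (Fin D) (Fin D) ℂ)
    (E : ι → Matrix (Fin D) (Fin D) ℂ) : ℝ≥0∞ :=
  ⨅ X ∈ directions D, chiForm σ E X

/-- The divergence rate written with directions:
`max_E min_X ∑_i Tr[E_i X]² / Tr[E_i σ]`, over all finite POVMs. -/
def dirDivergenceRate {D : ℕ} (σ : Matrix (Fin D) (Fin D) ℂ) : ℝ≥0∞ :=
  ⨆ (r : ℕ) (E : Fin r → Matrix (Fin D) (Fin D) ℂ) (_ : IsPOVM E), povmDirRate σ E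

/-- `0 < ε`, and `ε` is at most every nonzero eigenvalue of `σ`: then `σ + ε X` is a state for
each direction `X` that lives on the support of the state `σ`. -/
def IsSmallRadius {D : ℕ} (σ : Matrix (Fin D) (Fin D) ℂ) (ε : ℝ) : Prop :=
  0 < ε ∧ ∀ t : ℝ, t ≠ 0 → Module.End.HasEigenvalue (Matrix.toLin' σ) (t : ℂ) → ε ≤ t

/-- `S = diag(λ) - λ λᵀ`. -/
def covMatrix {D : ℕ} (lam : Fin D → ℝ) : Matrix (Fin D) (Fin D) ℝ :=
  Matrix.diagonal lam - Matrix.vecMulVec lam lam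

/-- The phase state `|χ⟩ = D^{-1/2} ∑_k e^{i θ_k} |k⟩` of the orthonormal basis `b`. -/
def phaseState {D : ℕ} (b : OrthonormalBasis (Fin D) ℂ (EuclideanSpace ℂ (Fin D)))
    (θ : Fin D → ℝ) : EuclideanSpace ℂ (Fin D) :=
  ((1 / Real.sqrt D : ℝ) : ℂ) • ∑ k, Complex.exp (Complex.I * (θ k : ℂ)) • b k

/-- The unitary `∑_k e^{i φ_k} |k⟩⟨k|`, diagonal in the basis `b`. -/
def phaseUnitary {D : ℕ} (b : OrthonormalBasis (Fin D) ℂ (EuclideanSpace ℂ (Fin D)))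
    (φ : Fin D → ℝ) : Matrix (Fin D) (Fin D) ℂ :=
  ∑ k, Complex.exp (Complex.I * (φ k : ℂ)) • proj (b k)

/-- The superoperator `X ↦ ∑_j ⟨χ_j|X|χ_j⟩ |χ_j⟩⟨χ_j|` of a family of phase states. -/
def phaseSuper {D m : ℕ} (b : OrthonormalBasis (Fin D) ℂ (EuclideanSpace ℂ (Fin D)))
    (θ : Fin m → Fin D → ℝ) (X : Matrix (Fin D) (Fin D) ℂ) : Matrix (Fin D) (Fin D) ℂ :=
  ∑ j, (proj (phaseState b (θ j)) * X).trace • proj (phaseState b (θ j))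

/-- Invariance of a family of phase states, as seen by this superoperator, under all similarity
transformations with the unitaries that are diagonal in the basis `b`. -/
def IsPhaseInvariant {D m : ℕ} (b : OrthonormalBasis (Fin D) ℂ (EuclideanSpace ℂ (Fin D)))
    (θ : Fin m → Fin D → ℝ) : Prop :=
  ∀ (φ : Fin D → ℝ) (X : Matrix (Fin D) (Fin D) ℂ),
    phaseSuper b θ (phaseUnitary b φ * X * (phaseUnitary b φ).conjTranspose) =
      phaseUnitary b φ * phaseSuper b θ X * (phaseUnitary b φ).conjTranspose

/-- The family `(1 - ξ) |i⟩⟨i|`, `1 ≤ i ≤ D`, together with `c |χ_j⟩⟨χ_j|`, `1 ≤ j ≤ m`. -/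
def phasePOVM {D m : ℕ} (b : OrthonormalBasis (Fin D) ℂ (EuclideanSpace ℂ (Fin D)))
    (ξ c : ℝ) (θ : Fin m → Fin D → ℝ) : Fin D ⊕ Fin m → Matrix (Fin D) (Fin D) ℂ :=
  Sum.elim (fun i => ((1 - ξ : ℝ) : ℂ) • proj (b i))
    (fun j => (c : ℂ) • proj (phaseState b (θ j)))

end QChiSq

end

/-! In the eigenbasis of `σ` an outcome has probability `p_i = ∑ λ_k ⟨k|E_i|k⟩`. The form to be kept
large on the unit sphere has two competing kinds of directions: diagonal ones and coherences between
two eigenvectors.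

Upper bound for mixed `σ`, where `μ > 0` (`exists_direction_chiForm_le`). Write the normalised top
eigenvector of `S` as `λ u`. Lagrange's identity with weights `λ_k ⟨k|E_i|k⟩`, divided by `p_i` and
summed over `i`, shows for every POVM that the form at `diag(λ u)`, plus `½ ∑_{j,k} λ_j λ_k (u_j -
u_k)²` with each term multiplied by `∑_i ⟨j|E_i|j⟩⟨k|E_i|k⟩ / p_i`, equals `∑ λ u² = 1/μ`. Each
factor dominates the form at some coherence between `j` and `k` (`exists_pairDir_le`), and the
coefficients add up to `1/μ`, by the same identity with weights `λ`. So weights of total `1 + 1/μ`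
give a sum of at most `1/μ`, and one of the directions has value at most `1/(1+μ)`.

Lower bound (`le_chiForm_phasePOVM`). Phase invariance amounts to trivial fourth moments. Such phase
states contribute exactly `ξ` times the squared off-diagonal norm of a traceless `X`. The basis
measurement has weight `1 - ξ = μ ξ` and contributes `μ ξ ∑ x²/λ ≥ ξ ∑ x²` for the diagonal `x`
(`sum_sq_le_mul_sum_div`). The sum is at least `ξ ‖X‖²`.

Homogeneity carries the lower bound to every `ε`. The directions of the upper bound live on the
support and have operator norm at most one, so `σ + ε X` is still a state for small radii
(`isState_diagonal_add_smul`). Minima exist by lower semicontinuity on compact sets, maxima because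
a POVM meets the upper bound.

The bound `μ ≤ 1/2` and its equality case come from the entry of largest modulus of an eigenvector.
For pure `σ` one has `μ = 0` and the basis part of the phase POVM disappears; phase vectors with
varying intensities replace it (`exists_isPOVM_one_le_chiForm`). The limit at pure states rests on
`μ ≤ 2 (1 - ‖σ'‖²)`. -/

namespace QChiSq
open Matrix

/-! ### The covariance matrix and its largest eigenvalue. -/

section Covariance

variable {D : ℕ}

lemma covMatrix_mulVec (lam v : Fin D → ℝ) (k : Fin D) :
    (covMatrix lam *ᵥ v) k = lam k * (v k - lam ⬝ᵥ v) := by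
  simp [covMatrix, sub_mulVec, mulVec_diagonal, vecMulVec_mulVec, mul_sub, mul_comm]

lemma covMatrix_isSymm (lam : Fin D → ℝ) : (covMatrix lam)ᵀ = covMatrix lam := by
  simp [covMatrix, transpose_sub, transpose_vecMulVec]

lemma dotProduct_covMatrix_mulVec (lam x : Fin D → ℝ) :
    x ⬝ᵥ (covMatrix lam *ᵥ x) = ∑ k, lam k * x k ^ 2 - (∑ k, lam k * x k) ^ 2 := by
  simp only [dotProduct, covMatrix_mulVec]
  rw [sq (∑ k, lam k * x k), Finset.sum_mul, ← Finset.sum_sub_distrib]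
  exact Finset.sum_congr rfl fun k _ => by ring

lemma hasEigenvalue_covMatrix_iff (lam : Fin D → ℝ) (t : ℝ) :
    Module.End.HasEigenvalue (toLin' (covMatrix lam)) t ↔
      ∃ v : Fin D → ℝ, v ≠ 0 ∧ ∀ k, lam k * (v k - lam ⬝ᵥ v) = t * v k := by
  constructor
  · intro h
    obtain ⟨v, hv⟩ := h.exists_hasEigenvector
    refine ⟨v, hv.2, fun k => ?_⟩
    have := congrFun hv.apply_eq_smul k
    rwa [toLin'_apply, covMatrix_mulVec] at this
  · rintro ⟨v, hv0, hv⟩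
    refine Module.End.hasEigenvalue_of_hasEigenvector (x := v)
      ⟨Module.End.mem_eigenspace_iff.2 ?_, hv0⟩
    ext k
    rw [toLin'_apply, covMatrix_mulVec, hv k]
    rfl

/-- The largest eigenvalue of the covariance matrix exists and bounds its quadratic form. -/
lemma exists_isGreatest_eigenvalue_covMatrix (hD : 0 < D) (lam : Fin D → ℝ) :
    ∃ μ : ℝ, IsGreatest {t : ℝ | Module.End.HasEigenvalue (toLin' (covMatrix lam)) t} μ ∧
      ∀ x : Fin D → ℝ, x ⬝ᵥ (covMatrix lam *ᵥ x) ≤ μ * (x ⬝ᵥ x) := by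
  have : Nonempty (Fin D) := ⟨⟨0, hD⟩⟩
  have hS : (covMatrix lam).IsHermitian := by
    rw [IsHermitian, conjTranspose_eq_transpose_of_trivial]
    exact covMatrix_isSymm lam
  obtain ⟨k, hk⟩ := Finite.exists_max hS.eigenvalues
  have hR : ∀ x : Fin D → ℝ,
      x ⬝ᵥ (covMatrix lam *ᵥ x) ≤ hS.eigenvalues k * (x ⬝ᵥ x) := by
    intro x
    have h1 : ∀ y z : Fin D → ℝ, inner ℝ (WithLp.toLp 2 y) (WithLp.toLp 2 z) = y ⬝ᵥ z := by
      intro y z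
      simp [EuclideanSpace.inner_eq_star_dotProduct, dotProduct_comm]
    have h2 := hS.eigenvectorBasis.sum_inner_mul_inner (WithLp.toLp 2 x)
      (WithLp.toLp 2 (covMatrix lam *ᵥ x))
    have h3 := hS.eigenvectorBasis.sum_inner_mul_inner (WithLp.toLp 2 x) (WithLp.toLp 2 x)
    rw [h1] at h2 h3
    rw [← h2, ← h3, Finset.mul_sum]
    refine Finset.sum_le_sum fun i _ => ?_
    have h4 : inner ℝ (hS.eigenvectorBasis i) (WithLp.toLp 2 (covMatrix lam *ᵥ x)) =
        hS.eigenvalues i * inner ℝ (hS.eigenvectorBasis i) (WithLp.toLp 2 x) := by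
      have e1 := h1 (hS.eigenvectorBasis i).ofLp (covMatrix lam *ᵥ x)
      have e2 := h1 (hS.eigenvectorBasis i).ofLp x
      simp only [WithLp.toLp_ofLp] at e1 e2
      rw [e1, e2, dotProduct_mulVec, ← mulVec_transpose, covMatrix_isSymm,
        hS.mulVec_eigenvectorBasis, smul_dotProduct, smul_eq_mul]
    rw [h4, real_inner_comm]
    nlinarith [hk i, mul_self_nonneg (inner ℝ (hS.eigenvectorBasis i) (WithLp.toLp 2 x))]
  refine ⟨hS.eigenvalues k, ⟨?_, ?_⟩, hR⟩
  · refine Module.End.hasEigenvalue_of_hasEigenvector (x := (hS.eigenvectorBasis k).ofLp)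
      ⟨Module.End.mem_eigenspace_iff.2 ?_, ?_⟩
    · rw [toLin'_apply, hS.mulVec_eigenvectorBasis]
    · intro h
      exact hS.eigenvectorBasis.orthonormal.ne_zero k ((WithLp.ofLp_eq_zero 2).1 h)
  · intro t ht
    obtain ⟨v, hv0, hv⟩ := (hasEigenvalue_covMatrix_iff lam t).1 ht
    have h1 := hR v
    have h2 : covMatrix lam *ᵥ v = t • v := by
      ext j
      rw [covMatrix_mulVec, hv j]
      rfl
    rw [h2, dotProduct_smul, smul_eq_mul] at h1
    have h3 : 0 < v ⬝ᵥ v :=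
      lt_of_le_of_ne (Finset.sum_nonneg fun i _ => mul_self_nonneg _)
        (Ne.symm (fun h => hv0 (dotProduct_self_eq_zero.1 h)))
    exact le_of_mul_le_mul_right h1 h3

variable {lam : Fin D → ℝ}

/-- An eigenvector of the covariance matrix is traceless and its relative deviations
`u = (v - c) / μ` satisfy `v = λ u` and `∑ λ u² = 1 / μ`. -/
lemma exists_relative_eigenvector (hlam : ∑ k, lam k = 1) {μ : ℝ} (hμ : μ ≠ 0)
    (h : Module.End.HasEigenvalue (toLin' (covMatrix lam)) μ) :
    ∃ u : Fin D → ℝ, ∑ k, lam k * u k = 0 ∧ ∑ k, (lam k * u k) ^ 2 = 1 ∧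
      ∑ k, lam k * u k ^ 2 = 1 / μ := by
  obtain ⟨v, hv0, hv⟩ := (hasEigenvalue_covMatrix_iff lam μ).1 h
  have hvv : 0 < ∑ k, v k ^ 2 := by
    obtain ⟨k, hk⟩ := Function.ne_iff.1 hv0
    exact Finset.sum_pos' (fun i _ => sq_nonneg _) ⟨k, Finset.mem_univ k, by
      have : v k ≠ 0 := hk
      positivity⟩
  set r := Real.sqrt (∑ k, v k ^ 2) with hr
  have hr0 : 0 < r := Real.sqrt_pos.2 hvv
  have hr2 : r ^ 2 = ∑ k, v k ^ 2 := Real.sq_sqrt hvv.le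
  have hu : ∀ k, lam k * ((v k - lam ⬝ᵥ v) / (μ * r)) = v k / r := by
    intro k
    rw [← mul_div_assoc, hv k]
    field_simp
  have hsum : ∑ k, v k = 0 := by
    have : μ * ∑ k, v k = 0 := by
      rw [Finset.mul_sum, ← Finset.sum_congr rfl fun k _ => hv k]
      simp only [mul_sub, Finset.sum_sub_distrib, ← Finset.sum_mul, hlam]
      simp [dotProduct]
    exact (mul_eq_zero.1 this).resolve_left hμ
  refine ⟨fun k => (v k - lam ⬝ᵥ v) / (μ * r), ?_, ?_, ?_⟩
  · simp only [hu, ← Finset.sum_div, hsum, zero_div]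
  · simp only [hu, div_pow, ← Finset.sum_div, ← hr2]
    field_simp
  · have : ∀ k, lam k * ((v k - lam ⬝ᵥ v) / (μ * r)) ^ 2 =
        (v k ^ 2 - (lam ⬝ᵥ v) * v k) / (μ * r ^ 2) := by
      intro k
      rw [sq, ← mul_assoc, hu k]
      field_simp
    simp only [this, ← Finset.sum_div, Finset.sum_sub_distrib, ← Finset.mul_sum, hsum, ← hr2]
    field_simp
    ring

/-- An eigenvalue of the covariance matrix is at most `2 λ_k (1 - λ_k)` for some `k`; in the case
of equality all the weight outside `k` sits on indices that can be used instead of `k`. -/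
lemma eigenvalue_covMatrix_le (hnn : ∀ k, 0 ≤ lam k) (hlam : ∑ k, lam k = 1) {μ : ℝ}
    (h : Module.End.HasEigenvalue (toLin' (covMatrix lam)) μ) :
    ∃ v : Fin D → ℝ, ∃ k, v k ≠ 0 ∧ μ ≤ 2 * lam k * (1 - lam k) ∧
      (∀ l, |v l| = |v k| → μ ≤ 2 * lam l * (1 - lam l)) ∧
      (μ = 2 * lam k * (1 - lam k) → 0 < lam k → ∀ l, l ≠ k → 0 < lam l → v l = - v k) := by
  obtain ⟨v, hv0, hv⟩ := (hasEigenvalue_covMatrix_iff lam μ).1 h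
  have : Nonempty (Fin D) := by
    obtain ⟨k, -⟩ := Function.ne_iff.1 hv0
    exact ⟨k⟩
  obtain ⟨k, hk⟩ := Finite.exists_max fun k => |v k|
  have hk0 : 0 < |v k| := by
    obtain ⟨l, hl⟩ := Function.ne_iff.1 hv0
    exact lt_of_lt_of_le (abs_pos.2 hl) (hk l)
  -- As `λ` has total mass one, the eigenvalue equation reads `μ v_k = λ_k ∑ λ_l (v_k - v_l)`; at an
  -- entry of largest modulus each difference is at most `2 |v_k|`.
  have hid : ∀ k, v k - lam ⬝ᵥ v = ∑ l, lam l * (v k - v l) := by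
    intro k
    simp only [mul_sub, Finset.sum_sub_distrib, ← Finset.sum_mul, hlam, one_mul]
    rfl
  have hsplit : ∀ k, ∑ l, lam l * (v k - v l) =
      ∑ l ∈ Finset.univ.erase k, lam l * (v k - v l) := by
    intro k
    rw [← Finset.add_sum_erase _ _ (Finset.mem_univ k)]
    simp
  have hrest : ∀ k, ∑ l ∈ Finset.univ.erase k, lam l = 1 - lam k := by
    intro k
    rw [← hlam, ← Finset.add_sum_erase _ _ (Finset.mem_univ k)]
    ring
  have hmul : ∀ k, μ * v k ^ 2 = lam k * ∑ l ∈ Finset.univ.erase k, lam l * (v k ^ 2 - v l * v k) := by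
    intro k
    have := hv k
    rw [hid, hsplit] at this
    calc μ * v k ^ 2 = (μ * v k) * v k := by ring
      _ = _ := by
        rw [← this, mul_assoc, Finset.sum_mul]
        congr 1
        exact Finset.sum_congr rfl fun l _ => by ring
  have hmain : ∀ j, |v j| = |v k| → μ ≤ 2 * lam j * (1 - lam j) := by
    intro j hj
    have hj2 : 0 < v j ^ 2 := by
      rw [← sq_abs, hj]; positivity
    refine le_of_mul_le_mul_right ?_ hj2
    rw [hmul j, ← hrest j]
    calc lam j * ∑ l ∈ Finset.univ.erase j, lam l * (v j ^ 2 - v l * v j)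
        ≤ lam j * ∑ l ∈ Finset.univ.erase j, lam l * (2 * v j ^ 2) := by
          refine mul_le_mul_of_nonneg_left (Finset.sum_le_sum fun l _ =>
            mul_le_mul_of_nonneg_left ?_ (hnn l)) (hnn j)
          have h1 : |v l| * |v j| ≤ |v j| * |v j| :=
            mul_le_mul_of_nonneg_right (hj ▸ hk l) (abs_nonneg _)
          have h2 := neg_abs_le (v l * v j)
          rw [abs_mul] at h2
          nlinarith [abs_mul_abs_self (v j)]
      _ = 2 * lam j * (∑ l ∈ Finset.univ.erase j, lam l) * v j ^ 2 := by
          rw [← Finset.sum_mul]; ring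
  refine ⟨v, k, abs_pos.1 hk0, hmain k rfl, hmain, ?_⟩
  intro heq hlk l hlne hl
  have h1 := hmul k
  rw [heq, ← hrest k] at h1
  -- In the case of equality the total slack is zero, and each of its terms is nonnegative, so every
  -- term vanishes.
  have h2 : ∑ l ∈ Finset.univ.erase k, lam l * (v k ^ 2 + v l * v k) = 0 := by
    have h3 : lam k * ∑ l ∈ Finset.univ.erase k, lam l * (v k ^ 2 + v l * v k) = 0 := by
      have h4 : ∑ l ∈ Finset.univ.erase k, lam l * (v k ^ 2 + v l * v k) =
          2 * (∑ l ∈ Finset.univ.erase k, lam l) * v k ^ 2 -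
            ∑ l ∈ Finset.univ.erase k, lam l * (v k ^ 2 - v l * v k) := by
        rw [Finset.mul_sum, Finset.sum_mul, ← Finset.sum_sub_distrib]
        exact Finset.sum_congr rfl fun l _ => by ring
      rw [h4, mul_sub, ← h1]
      ring
    exact (mul_eq_zero.1 h3).resolve_left hlk.ne'
  have h5 : ∀ l ∈ Finset.univ.erase k, 0 ≤ lam l * (v k ^ 2 + v l * v k) := by
    intro l _
    refine mul_nonneg (hnn l) ?_
    have h1 : |v l| * |v k| ≤ |v k| * |v k| :=
      mul_le_mul_of_nonneg_right (hk l) (abs_nonneg _)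
    have h2 := neg_abs_le (v l * v k)
    rw [abs_mul] at h2
    nlinarith [abs_mul_abs_self (v k)]
  have h6 := (Finset.sum_eq_zero_iff_of_nonneg h5).1 h2 l
    (Finset.mem_erase.2 ⟨hlne, Finset.mem_univ l⟩)
  have h7 : v k * (v k + v l) = 0 := by
    have := (mul_eq_zero.1 h6).resolve_left hl.ne'
    linarith [this, sq (v k), mul_comm (v l) (v k), mul_add (v k) (v k) (v l)]
  have := (mul_eq_zero.1 h7).resolve_left (abs_pos.1 hk0)
  linarith

lemma eigenvalue_covMatrix_le_half (hnn : ∀ k, 0 ≤ lam k) (hlam : ∑ k, lam k = 1) {μ : ℝ}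
    (h : Module.End.HasEigenvalue (toLin' (covMatrix lam)) μ) : μ ≤ 1 / 2 := by
  obtain ⟨v, k, -, hk, -⟩ := eigenvalue_covMatrix_le hnn hlam h
  nlinarith [sq_nonneg (lam k - 1 / 2)]

lemma eigenvalue_covMatrix_eq_half (hnn : ∀ k, 0 ≤ lam k) (hlam : ∑ k, lam k = 1)
    (h : Module.End.HasEigenvalue (toLin' (covMatrix lam)) (1 / 2)) :
    ∃ i j : Fin D, i ≠ j ∧ lam i = 1 / 2 ∧ lam j = 1 / 2 ∧ ∀ k, k ≠ i → k ≠ j → lam k = 0 := by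
  obtain ⟨v, i, -, hi, hmax, hne⟩ := eigenvalue_covMatrix_le hnn hlam h
  have half : ∀ x : ℝ, 1 / 2 ≤ 2 * x * (1 - x) → x = 1 / 2 := by
    intro x hx
    nlinarith [sq_nonneg (x - 1 / 2)]
  have hi2 := half _ hi
  have hsum : ∑ l ∈ Finset.univ.erase i, lam l = 1 / 2 := by
    have := Finset.add_sum_erase Finset.univ lam (Finset.mem_univ i)
    rw [hlam, hi2] at this
    linarith
  -- Half of the mass lies outside `i`. An index `j` carrying some of it has `v_j = -v_i` by
  -- equality, hence obeys the same bound as `i` and has weight `1/2` too; nothing is left for the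
  -- others.
  obtain ⟨j, hj, hj0⟩ := Finset.exists_ne_zero_of_sum_ne_zero (hsum.trans_ne (by norm_num))
  have hji : j ≠ i := (Finset.mem_erase.1 hj).1
  have hvj := hne (by rw [hi2]; norm_num) (by rw [hi2]; norm_num) j hji
    (lt_of_le_of_ne (hnn j) hj0.symm)
  have hj2 := half _ (hmax j (by rw [hvj, abs_neg]))
  refine ⟨i, j, hji.symm, hi2, hj2, fun k hki hkj => ?_⟩
  have hk := Finset.single_le_sum (fun l _ => hnn l)
    (Finset.mem_erase.2 ⟨hkj, Finset.mem_erase.2 ⟨hki, Finset.mem_univ k⟩⟩)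
  have h3 := Finset.add_sum_erase (Finset.univ.erase i) lam hj
  linarith [hnn k]

lemma hasEigenvalue_covMatrix_half {i j : Fin D} (hij : i ≠ j) (hi : lam i = 1 / 2)
    (hj : lam j = 1 / 2) (hk : ∀ k, k ≠ i → k ≠ j → lam k = 0) :
    Module.End.HasEigenvalue (toLin' (covMatrix lam)) (1 / 2) := by
  rw [hasEigenvalue_covMatrix_iff]
  refine ⟨Pi.single i 1 - Pi.single j 1, ?_, fun k => ?_⟩
  · intro h
    have := congrFun h i
    simp [hij] at this
  · have h0 : lam ⬝ᵥ (Pi.single i 1 - Pi.single j 1) = 0 := by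
      simp [dotProduct_sub, hi, hj]
    rw [h0, sub_zero]
    by_cases h1 : k = i
    · rw [h1, hi]
    · by_cases h2 : k = j
      · rw [h2, hj]
      · simp [h1, h2, hk k h1 h2]

/-- The variance of `z` under the distribution `λ` is nonnegative. -/
lemma sq_sum_mul_le (hnn : ∀ k, 0 ≤ lam k) (hlam : ∑ k, lam k = 1) (z : Fin D → ℝ) :
    (∑ k, lam k * z k) ^ 2 ≤ ∑ k, lam k * z k ^ 2 := by
  have h : 0 ≤ ∑ k, lam k * (z k - ∑ l, lam l * z l) ^ 2 :=
    Finset.sum_nonneg fun k _ => mul_nonneg (hnn k) (sq_nonneg _)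
  generalize hm : ∑ l, lam l * z l = m at *
  have h2 : ∑ k, lam k * (z k - m) ^ 2 =
      ∑ k, lam k * z k ^ 2 - 2 * m * ∑ k, lam k * z k + m ^ 2 * ∑ k, lam k := by
    simp only [Finset.mul_sum, ← Finset.sum_sub_distrib, ← Finset.sum_add_distrib]
    exact Finset.sum_congr rfl fun k _ => by ring
  rw [h2, hm, hlam] at h
  linarith

/-- The dual form of the covariance matrix is bounded below by `1 / μ`. -/
lemma sum_sq_le_mul_sum_div (hnn : ∀ k, 0 ≤ lam k) (hlam : ∑ k, lam k = 1) {μ : ℝ} (hμ : 0 < μ)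
    (hR : ∀ x : Fin D → ℝ, x ⬝ᵥ (covMatrix lam *ᵥ x) ≤ μ * (x ⬝ᵥ x))
    {x : Fin D → ℝ} (hx : ∑ k, x k = 0) (hsupp : ∀ k, lam k = 0 → x k = 0) :
    ∑ k, x k ^ 2 ≤ μ * ∑ k, x k ^ 2 / lam k := by
  -- With `N = ∑ x²` and `Q = ∑ x²/λ`, the nonnegative variance of this function, times `μ²`, is `μ²
  -- Q - 2 μ N + xᵀSx`. Since `xᵀSx ≤ μ N`, this gives `N ≤ μ Q`.
  have h1 := sq_sum_mul_le hnn hlam fun k => x k / lam k - x k / μ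
  have h2 := hR x
  rw [dotProduct_covMatrix_mulVec] at h2
  have hN : x ⬝ᵥ x = ∑ k, x k ^ 2 := Finset.sum_congr rfl fun k _ => (sq _).symm
  rw [hN] at h2
  have e1 : ∑ k, lam k * (x k / lam k - x k / μ) = - (∑ k, lam k * x k) / μ := by
    have : ∀ k, lam k * (x k / lam k - x k / μ) = x k - lam k * x k / μ := by
      intro k
      by_cases h : lam k = 0
      · simp [hsupp k h]
      · field_simp
    simp only [this, Finset.sum_sub_distrib, hx, ← Finset.sum_div, zero_sub, neg_div]
  have e2 : ∑ k, lam k * (x k / lam k - x k / μ) ^ 2 = ∑ k, x k ^ 2 / lam k -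
      2 * (∑ k, x k ^ 2) / μ + (∑ k, lam k * x k ^ 2) / μ ^ 2 := by
    rw [Finset.mul_sum, Finset.sum_div, Finset.sum_div, ← Finset.sum_sub_distrib,
      ← Finset.sum_add_distrib]
    refine Finset.sum_congr rfl fun k _ => ?_
    by_cases h : lam k = 0
    · simp [hsupp k h]
    · field_simp
      ring
  rw [e1, e2, div_pow, neg_sq] at h1
  have h3 : 0 ≤ μ ^ 2 * (∑ k, x k ^ 2 / lam k) - 2 * μ * (∑ k, x k ^ 2) +
      ((∑ k, lam k * x k ^ 2) - (∑ k, lam k * x k) ^ 2) := by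
    have := mul_le_mul_of_nonneg_left h1 (sq_nonneg μ)
    have e3 : μ ^ 2 * ((∑ k, lam k * x k) ^ 2 / μ ^ 2) = (∑ k, lam k * x k) ^ 2 := by field_simp
    have e4 : μ ^ 2 * (∑ k, x k ^ 2 / lam k - 2 * (∑ k, x k ^ 2) / μ +
        (∑ k, lam k * x k ^ 2) / μ ^ 2) = μ ^ 2 * (∑ k, x k ^ 2 / lam k) -
        2 * μ * (∑ k, x k ^ 2) + (∑ k, lam k * x k ^ 2) := by field_simp
    linarith
  refine le_of_mul_le_mul_left ?_ hμ
  nlinarith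

/-- The largest eigenvalue of the covariance matrix vanishes exactly for point masses. -/
lemma largest_eigenvalue_eq_zero_iff (hnn : ∀ k, 0 ≤ lam k) (hlam : ∑ k, lam k = 1) {μ : ℝ}
    (h : Module.End.HasEigenvalue (toLin' (covMatrix lam)) μ)
    (hR : ∀ x : Fin D → ℝ, x ⬝ᵥ (covMatrix lam *ᵥ x) ≤ μ * (x ⬝ᵥ x)) :
    0 ≤ μ ∧ (μ = 0 ↔ ∃ k, lam k = 1) := by
  have hle : ∀ k, lam k ≤ 1 := fun k =>
    hlam ▸ Finset.single_le_sum (fun l _ => hnn l) (Finset.mem_univ k)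
  -- The quadratic form of `S` at the `k`-th basis vector, a diagonal entry of `S`.
  have hk : ∀ k, lam k * (1 - lam k) ≤ μ := by
    intro k
    have := hR (Pi.single k 1)
    rw [dotProduct_covMatrix_mulVec] at this
    simp [Pi.single_apply] at this
    linarith
  have hD : Nonempty (Fin D) := by
    by_contra hne
    rw [not_nonempty_iff] at hne
    simp at hlam
  refine ⟨(mul_nonneg (hnn hD.some) (by linarith [hle hD.some])).trans (hk hD.some), ?_, ?_⟩
  · rintro rfl
    obtain ⟨k, -, hk0⟩ := Finset.exists_ne_zero_of_sum_ne_zero (hlam.trans_ne one_ne_zero)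
    refine ⟨k, ?_⟩
    have h1 := le_antisymm (hk k) (mul_nonneg (hnn k) (by linarith [hle k]))
    linarith [(mul_eq_zero.1 h1).resolve_left hk0]
  · rintro ⟨k, hk1⟩
    have h0 : ∀ l, l ≠ k → lam l = 0 := by
      intro l hl
      have h3 := Finset.add_sum_erase Finset.univ lam (Finset.mem_univ k)
      have h4 := Finset.single_le_sum (fun l _ => hnn l)
        (Finset.mem_erase.2 ⟨hl, Finset.mem_univ l⟩)
      linarith [hnn l]
    obtain ⟨v, i, -, hi, -⟩ := eigenvalue_covMatrix_le hnn hlam h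
    have h1 : 2 * lam i * (1 - lam i) = 0 := by
      by_cases hik : i = k
      · rw [hik, hk1]; ring
      · rw [h0 i hik]; ring
    have h2 := hk i
    have := (mul_nonneg (hnn i) (by linarith [hle i])).trans h2
    linarith

/-- The largest eigenvalue of the covariance matrix is at most its trace. -/
lemma eigenvalue_covMatrix_le_trace (hnn : ∀ k, 0 ≤ lam k) (hlam : ∑ k, lam k = 1) {μ : ℝ}
    (h : Module.End.HasEigenvalue (toLin' (covMatrix lam)) μ) :
    μ ≤ 2 * (1 - ∑ k, lam k ^ 2) := by
  -- The entrywise estimate loses a factor 2 against the trace `1 - ∑ λ²`. This is harmless: the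
  -- bound only has to vanish as the purity tends to one.
  obtain ⟨v, i, -, hi, -⟩ := eigenvalue_covMatrix_le hnn hlam h
  have hle : ∀ k, lam k ≤ 1 := fun k =>
    hlam ▸ Finset.single_le_sum (fun l _ => hnn l) (Finset.mem_univ k)
  have h1 : 1 - ∑ k, lam k ^ 2 = ∑ k, lam k * (1 - lam k) := by
    rw [← hlam, ← Finset.sum_sub_distrib, hlam]
    exact Finset.sum_congr rfl fun k _ => by ring
  have h2 := Finset.single_le_sum (f := fun k => lam k * (1 - lam k))
    (fun l _ => mul_nonneg (hnn l) (by linarith [hle l])) (Finset.mem_univ i)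
  rw [h1]
  linarith

end Covariance

/-! ### Passing to the eigenbasis. -/

section Frame

variable {D : ℕ}

/-- The unitary matrix whose columns are the vectors of the basis. -/
noncomputable def frame (b : OrthonormalBasis (Fin D) ℂ (EuclideanSpace ℂ (Fin D))) :
    Matrix (Fin D) (Fin D) ℂ :=
  of fun i k => (b k).ofLp i

variable (b : OrthonormalBasis (Fin D) ℂ (EuclideanSpace ℂ (Fin D)))

lemma frame_conjTranspose_mul : (frame b)ᴴ * frame b = 1 := by
  ext k l
  have h := orthonormal_iff_ite.1 b.orthonormal k l
  rw [EuclideanSpace.inner_eq_star_dotProduct] at h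
  rw [mul_apply, one_apply, ← h]
  simp [frame, dotProduct, mul_comm]

lemma frame_mul_conjTranspose : frame b * (frame b)ᴴ = 1 :=
  mul_eq_one_comm.1 (frame_conjTranspose_mul b)

/-- The matrix of an operator in the basis `b`. -/
noncomputable def rot (X : Matrix (Fin D) (Fin D) ℂ) : Matrix (Fin D) (Fin D) ℂ :=
  (frame b)ᴴ * X * frame b

/-- The operator with a given matrix in the basis `b`. -/
noncomputable def unrot (X : Matrix (Fin D) (Fin D) ℂ) : Matrix (Fin D) (Fin D) ℂ :=
  frame b * X * (frame b)ᴴ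

lemma rot_unrot (X : Matrix (Fin D) (Fin D) ℂ) : rot b (unrot b X) = X := by
  have := frame_conjTranspose_mul b
  calc rot b (unrot b X) = ((frame b)ᴴ * frame b) * X * ((frame b)ᴴ * frame b) := by
        simp only [rot, unrot, Matrix.mul_assoc]
    _ = X := by rw [this, Matrix.one_mul, Matrix.mul_one]

lemma unrot_rot (X : Matrix (Fin D) (Fin D) ℂ) : unrot b (rot b X) = X := by
  have := frame_mul_conjTranspose b
  calc unrot b (rot b X) = (frame b * (frame b)ᴴ) * X * (frame b * (frame b)ᴴ) := by
        simp only [rot, unrot, Matrix.mul_assoc]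
    _ = X := by rw [this, Matrix.one_mul, Matrix.mul_one]

lemma rot_injective : Function.Injective (rot b) :=
  Function.LeftInverse.injective (unrot_rot b)

lemma rot_mul (X Y : Matrix (Fin D) (Fin D) ℂ) : rot b (X * Y) = rot b X * rot b Y := by
  have := frame_mul_conjTranspose b
  calc rot b (X * Y) = (frame b)ᴴ * X * 1 * Y * frame b := by
        simp only [rot, Matrix.mul_assoc, Matrix.mul_one]
    _ = _ := by rw [← this]; simp only [rot, Matrix.mul_assoc]

lemma rot_conjTranspose (X : Matrix (Fin D) (Fin D) ℂ) : rot b Xᴴ = (rot b X)ᴴ := by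
  simp [rot, Matrix.mul_assoc]

lemma rot_one : rot b 1 = 1 := by
  simp [rot, frame_conjTranspose_mul]

lemma rot_add (X Y : Matrix (Fin D) (Fin D) ℂ) : rot b (X + Y) = rot b X + rot b Y := by
  simp [rot, Matrix.mul_add, Matrix.add_mul]

lemma rot_smul (c : ℂ) (X : Matrix (Fin D) (Fin D) ℂ) : rot b (c • X) = c • rot b X := by
  simp [rot]

lemma rot_zero : rot b 0 = 0 := by simp [rot]

lemma rot_sum {ι : Type*} (s : Finset ι) (X : ι → Matrix (Fin D) (Fin D) ℂ) :
    rot b (∑ i ∈ s, X i) = ∑ i ∈ s, rot b (X i) := by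
  simp [rot, Matrix.mul_sum, Matrix.sum_mul]

lemma trace_rot (X : Matrix (Fin D) (Fin D) ℂ) : (rot b X).trace = X.trace := by
  rw [rot, Matrix.mul_assoc, trace_mul_comm, Matrix.mul_assoc, frame_mul_conjTranspose,
    Matrix.mul_one]

lemma frobNorm_rot (X : Matrix (Fin D) (Fin D) ℂ) : frobNorm (rot b X) = frobNorm X := by
  rw [frobNorm, frobNorm, ← rot_conjTranspose, ← rot_mul, trace_rot]

lemma isHermitian_rot_iff {X : Matrix (Fin D) (Fin D) ℂ} :
    (rot b X).IsHermitian ↔ X.IsHermitian := by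
  rw [IsHermitian, IsHermitian, ← rot_conjTranspose, (rot_injective b).eq_iff]

lemma posSemidef_rot_iff {X : Matrix (Fin D) (Fin D) ℂ} :
    (rot b X).PosSemidef ↔ X.PosSemidef := by
  refine ⟨fun h => ?_, fun h => h.conjTranspose_mul_mul_same _⟩
  rw [← unrot_rot b X]
  exact h.mul_mul_conjTranspose_same _

lemma born_rot {ι : Type*} (E : ι → Matrix (Fin D) (Fin D) ℂ) (X : Matrix (Fin D) (Fin D) ℂ) :
    born (fun i => rot b (E i)) (rot b X) = born E X := by
  ext i
  rw [born, born, ← rot_mul, trace_rot]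

lemma chiForm_rot {ι : Type*} [Fintype ι] (σ X : Matrix (Fin D) (Fin D) ℂ)
    (E : ι → Matrix (Fin D) (Fin D) ℂ) :
    chiForm (rot b σ) (fun i => rot b (E i)) (rot b X) = chiForm σ E X := by
  rw [chiForm, chiForm, born_rot, born_rot]

lemma isPOVM_rot_iff {ι : Type*} [Fintype ι] {E : ι → Matrix (Fin D) (Fin D) ℂ} :
    IsPOVM (fun i => rot b (E i)) ↔ IsPOVM E := by
  simp only [IsPOVM, posSemidef_rot_iff, ← rot_sum]
  nth_rw 1 [← rot_one b]
  rw [(rot_injective b).eq_iff]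

lemma isState_rot_iff {X : Matrix (Fin D) (Fin D) ℂ} : IsState (rot b X) ↔ IsState X := by
  rw [IsState, IsState, posSemidef_rot_iff, trace_rot]

lemma rot_mem_directions_iff {X : Matrix (Fin D) (Fin D) ℂ} :
    rot b X ∈ directions D ↔ X ∈ directions D := by
  simp only [directions, Set.mem_ofPred_eq, isHermitian_rot_iff, trace_rot, frobNorm_rot]

lemma rot_eigenbasis {σ : Matrix (Fin D) (Fin D) ℂ} {lam : Fin D → ℝ}
    (hb : ∀ α, toEuclideanLin σ (b α) = (lam α : ℂ) • b α) :
    rot b σ = diagonal fun k => (lam k : ℂ) := by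
  have h : σ * frame b = frame b * diagonal fun k => (lam k : ℂ) := by
    ext i k
    have := congrArg (fun v : EuclideanSpace ℂ (Fin D) => v.ofLp i) (hb k)
    rw [mul_diagonal]
    simpa [mul_apply, frame, mulVec, dotProduct, mul_comm, toLpLin_apply] using this
  rw [rot, Matrix.mul_assoc, h, ← Matrix.mul_assoc, frame_conjTranspose_mul, Matrix.one_mul]

lemma rot_proj (ψ : EuclideanSpace ℂ (Fin D)) :
    rot b (proj ψ) = vecMulVec ((frame b)ᴴ *ᵥ ψ.ofLp) (star ((frame b)ᴴ *ᵥ ψ.ofLp)) := by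
  rw [rot, proj, mul_vecMulVec, vecMulVec_mul, star_mulVec, conjTranspose_conjTranspose]

lemma frame_mulVec (z : Fin D → ℂ) : frame b *ᵥ z = (∑ k, z k • b k).ofLp := by
  ext i
  simp [frame, mulVec, dotProduct, mul_comm]

lemma frame_conjTranspose_mulVec_sum (z : Fin D → ℂ) :
    (frame b)ᴴ *ᵥ (∑ k, z k • b k).ofLp = z := by
  rw [← frame_mulVec, mulVec_mulVec, frame_conjTranspose_mul, one_mulVec]

lemma rot_proj_sum (z : Fin D → ℂ) :
    rot b (proj (∑ k, z k • b k)) = vecMulVec z (star z) := by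
  rw [rot_proj, frame_conjTranspose_mulVec_sum]

lemma rot_proj_basis (i : Fin D) : rot b (proj (b i)) = single i i 1 := by
  have : b i = ∑ k, (Pi.single i 1 : Fin D → ℂ) k • b k := by
    simp [Pi.single_apply]
  rw [this, rot_proj_sum]
  ext k l
  simp [vecMulVec_apply, single_apply, Pi.single_apply]
  grind

/-- The coordinates `e^{i θ_k}` of a phase state, up to normalisation. -/
noncomputable def phases (θ : Fin D → ℝ) : Fin D → ℂ := fun k => Complex.exp (Complex.I * (θ k : ℂ))

lemma star_phases_mul (θ : Fin D → ℝ) (k : Fin D) : star (phases θ k) * phases θ k = 1 := by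
  rw [phases, Complex.star_def, ← Complex.exp_conj, ← Complex.exp_add]
  simp

lemma rot_proj_phaseState (θ : Fin D → ℝ) :
    rot b (proj (phaseState b θ)) =
      ((1 / D : ℝ) : ℂ) • vecMulVec (phases θ) (star (phases θ)) := by
  have h : phaseState b θ =
      ∑ k, (((1 / Real.sqrt D : ℝ) : ℂ) • phases θ) k • b k := by
    simp only [phaseState, phases, Finset.smul_sum, smul_smul, Pi.smul_apply, smul_eq_mul]
  rw [h, rot_proj_sum, star_smul, smul_vecMulVec, vecMulVec_smul, smul_smul]
  congr 1
  rw [Complex.star_def, Complex.conj_ofReal, ← Complex.ofReal_mul]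
  congr 1
  rw [div_mul_div_comm, one_mul, Real.mul_self_sqrt (Nat.cast_nonneg D)]

lemma rot_phaseUnitary (φ : Fin D → ℝ) : rot b (phaseUnitary b φ) = diagonal (phases φ) := by
  rw [phaseUnitary, rot_sum]
  simp only [rot_smul, rot_proj_basis]
  ext k l
  simp [Matrix.sum_apply, single_apply, diagonal_apply, phases]
  by_cases h : k = l
  · simp [h]
  · simp only [h, if_false]
    exact Finset.sum_eq_zero fun c _ => if_neg (by grind)

end Frame

/-! ### The Frobenius norm and compactness. -/

section Frobenius

variable {D : ℕ}

lemma trace_conjTranspose_mul_self_re (X : Matrix (Fin D) (Fin D) ℂ) :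
    (Xᴴ * X).trace.re = ∑ a, ∑ c, ‖X a c‖ ^ 2 := by
  rw [Finset.sum_comm]
  simp only [trace, diag_apply, mul_apply, conjTranspose_apply, Complex.re_sum]
  refine Finset.sum_congr rfl fun c _ => Finset.sum_congr rfl fun a _ => ?_
  rw [Complex.star_def, ← Complex.normSq_eq_conj_mul_self, Complex.ofReal_re, Complex.sq_norm]

lemma frobNorm_sq (X : Matrix (Fin D) (Fin D) ℂ) :
    frobNorm X ^ 2 = ∑ a, ∑ c, ‖X a c‖ ^ 2 := by
  rw [frobNorm, Real.sq_sqrt, trace_conjTranspose_mul_self_re]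
  rw [trace_conjTranspose_mul_self_re]
  positivity

lemma frobNorm_nonneg (X : Matrix (Fin D) (Fin D) ℂ) : 0 ≤ frobNorm X := Real.sqrt_nonneg _

lemma frobNorm_eq_iff {X : Matrix (Fin D) (Fin D) ℂ} {r : ℝ} (hr : 0 ≤ r) :
    frobNorm X = r ↔ ∑ a, ∑ c, ‖X a c‖ ^ 2 = r ^ 2 := by
  rw [← frobNorm_sq, sq_eq_sq₀ (frobNorm_nonneg X) hr]

lemma frobNorm_smul {ε : ℝ} (hε : 0 ≤ ε) (X : Matrix (Fin D) (Fin D) ℂ) :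
    frobNorm ((ε : ℂ) • X) = ε * frobNorm X := by
  rw [frobNorm_eq_iff (mul_nonneg hε (frobNorm_nonneg X)), mul_pow, frobNorm_sq]
  simp [mul_pow, Finset.mul_sum]

lemma continuous_frobNorm : Continuous (frobNorm : Matrix (Fin D) (Fin D) ℂ → ℝ) := by
  unfold frobNorm
  fun_prop

/-- The Cauchy-Schwarz inequality for the entries of a positive semidefinite matrix. -/
lemma norm_sq_entry_le {A : Matrix (Fin D) (Fin D) ℂ} (hA : A.PosSemidef) (a c : Fin D) :
    ‖A a c‖ ^ 2 ≤ (A a a).re * (A c c).re := by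
  -- The `2 × 2` principal minor; repeated indices `a = c` are allowed.
  have h := (hA.submatrix ![a, c]).det_nonneg
  rw [det_fin_two] at h
  simp only [submatrix_apply, cons_val_zero, cons_val_one] at h
  have h1 : A c a = star (A a c) := (hA.1.apply c a).symm
  have haa := Complex.nonneg_iff.1 (hA.diag_nonneg (i := a))
  have hcc := Complex.nonneg_iff.1 (hA.diag_nonneg (i := c))
  rw [h1, Complex.star_def, Complex.mul_conj, Complex.nonneg_iff] at h
  have h2 := h.1
  simp only [Complex.sub_re, Complex.mul_re, Complex.ofReal_re, ← haa.2, ← hcc.2] at h2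
  rw [Complex.sq_norm]
  linarith

lemma isCompact_frobNorm_le (r : ℝ) :
    IsCompact {X : Matrix (Fin D) (Fin D) ℂ | frobNorm X ≤ r} := by
  refine IsCompact.of_isClosed_subset (s := Set.univ.pi fun _ => Set.univ.pi fun _ =>
    Metric.closedBall (0 : ℂ) r)
    (isCompact_univ_pi fun _ => isCompact_univ_pi fun _ => isCompact_closedBall 0 r)
    (isClosed_le continuous_frobNorm continuous_const) ?_
  intro X hX a _ c _
  rw [mem_closedBall_zero_iff]
  refine le_trans ?_ hX
  refine abs_le_of_sq_le_sq' ?_ (frobNorm_nonneg X) |>.2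
  refine le_of_le_of_eq ?_ (frobNorm_sq X).symm
  exact (Finset.single_le_sum (f := fun c => ‖X a c‖ ^ 2) (fun _ _ => sq_nonneg _)
    (Finset.mem_univ c)).trans (Finset.single_le_sum (f := fun a => ∑ c, ‖X a c‖ ^ 2)
      (fun _ _ => Finset.sum_nonneg fun _ _ => sq_nonneg _) (Finset.mem_univ a))

lemma frobNorm_le_one_of_isState {ρ : Matrix (Fin D) (Fin D) ℂ} (h : IsState ρ) :
    frobNorm ρ ≤ 1 := by
  refine abs_le_of_sq_le_sq' ?_ zero_le_one |>.2
  rw [frobNorm_sq]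
  have htr : ∑ a, (ρ a a).re = 1 := by
    have := congrArg Complex.re h.2
    simpa [trace] using this
  calc ∑ a, ∑ c, ‖ρ a c‖ ^ 2 ≤ ∑ a, ∑ c, (ρ a a).re * (ρ c c).re :=
        Finset.sum_le_sum fun a _ => Finset.sum_le_sum fun c _ => norm_sq_entry_le h.1 a c
    _ = 1 ^ 2 := by simp [← Finset.mul_sum, htr]

lemma isClosed_isState : IsClosed {ρ : Matrix (Fin D) (Fin D) ℂ | IsState ρ} := by
  have : {ρ : Matrix (Fin D) (Fin D) ℂ | IsState ρ} =
      ({ρ | ρᴴ = ρ} ∩ ⋂ x : Fin D → ℂ, {ρ | 0 ≤ star x ⬝ᵥ ρ *ᵥ x}) ∩ {ρ | ρ.trace = 1} := by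
    ext ρ
    simp [IsState, posSemidef_iff_dotProduct_mulVec, IsHermitian]
  rw [this]
  refine ((isClosed_eq (by fun_prop) continuous_id).inter (isClosed_iInter fun x => ?_)).inter
    (isClosed_eq (by fun_prop) continuous_const)
  have hc : Continuous fun ρ : Matrix (Fin D) (Fin D) ℂ => star x ⬝ᵥ ρ *ᵥ x := by fun_prop
  simp only [Complex.nonneg_iff]
  exact (isClosed_le continuous_const (Complex.continuous_re.comp hc)).inter
    (isClosed_eq continuous_const (Complex.continuous_im.comp hc))

lemma isCompact_alternatives (σ : Matrix (Fin D) (Fin D) ℂ) (ε : ℝ) :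
    IsCompact (alternatives σ ε) := by
  refine (isCompact_frobNorm_le 1).of_isClosed_subset (isClosed_isState.inter
    (isClosed_le continuous_const (continuous_frobNorm.comp (by fun_prop)))) ?_
  exact fun ρ hρ => frobNorm_le_one_of_isState hρ.1

lemma isCompact_directions : IsCompact (directions D) := by
  refine (isCompact_frobNorm_le 1).of_isClosed_subset ?_ fun X hX => hX.2.2.le
  exact (isClosed_eq (by fun_prop) continuous_id).inter
    ((isClosed_eq (by fun_prop) continuous_const).inter
      (isClosed_eq continuous_frobNorm continuous_const))

end Frobenius

/-! ### Semicontinuity, attained minima, and the passage between directions and radii. -/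

section Rates

variable {D : ℕ} {ι : Type*}

lemma born_sub (E : ι → Matrix (Fin D) (Fin D) ℂ) (X Y : Matrix (Fin D) (Fin D) ℂ) (i : ι) :
    born E (X - Y) i = born E X i - born E Y i := by
  simp [born, Matrix.mul_sub]

lemma born_smul (E : ι → Matrix (Fin D) (Fin D) ℂ) (r : ℝ) (X : Matrix (Fin D) (Fin D) ℂ)
    (i : ι) : born E ((r : ℂ) • X) i = r * born E X i := by
  simp [born]

variable [Fintype ι] {σ : Matrix (Fin D) (Fin D) ℂ} {E : ι → Matrix (Fin D) (Fin D) ℂ}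

lemma chiSq_eq_chiForm (σ ρ : Matrix (Fin D) (Fin D) ℂ) (E : ι → Matrix (Fin D) (Fin D) ℂ) :
    chiSq (born E σ) (born E ρ) = chiForm σ E (ρ - σ) := by
  simp only [chiSq, chiForm, born_sub]

lemma chiForm_smul (σ X : Matrix (Fin D) (Fin D) ℂ) (E : ι → Matrix (Fin D) (Fin D) ℂ) (r : ℝ) :
    chiForm σ E ((r : ℂ) • X) = ENNReal.ofReal (r ^ 2) * chiForm σ E X := by
  simp only [chiForm, born_smul, Finset.mul_sum, mul_pow, ENNReal.ofReal_mul (sq_nonneg r),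
    mul_div_assoc]

/-- With no outcome that is impossible under `σ` but not under `X`, the form is a finite sum of
reals. -/
lemma chiForm_eq_ofReal {X : Matrix (Fin D) (Fin D) ℂ} (hp : ∀ i, 0 ≤ born E σ i)
    (h : ∀ i, born E σ i = 0 → born E X i = 0) :
    chiForm σ E X = ENNReal.ofReal (∑ i, born E X i ^ 2 / born E σ i) := by
  rw [chiForm, ENNReal.ofReal_sum_of_nonneg fun i _ => div_nonneg (sq_nonneg _) (hp i)]
  refine Finset.sum_congr rfl fun i _ => ?_
  by_cases h0 : born E σ i = 0
  · simp [h0, h i h0]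
  · rw [ENNReal.ofReal_div_of_pos (lt_of_le_of_ne (hp i) (Ne.symm h0))]

lemma chiForm_eq_top {X : Matrix (Fin D) (Fin D) ℂ} {i : ι} (hi : born E σ i = 0)
    (hX : born E X i ≠ 0) : chiForm σ E X = ⊤ := by
  refine ENNReal.sum_eq_top.2 ⟨i, Finset.mem_univ i, ?_⟩
  rw [hi, ENNReal.ofReal_zero, ENNReal.div_zero]
  exact (ENNReal.ofReal_pos.2 (by positivity)).ne'

/-- For `c = 0` the quotient jumps from `0` to `∞` off the zero set of `f`. That region is open, so
lower semicontinuity survives, and this is enough for minima on compact sets. -/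
lemma lowerSemicontinuous_div_const {α : Type*} [TopologicalSpace α] {f : α → ℝ≥0∞}
    (hf : Continuous f) (c : ℝ≥0∞) : LowerSemicontinuous fun x => f x / c := by
  by_cases hc : c = 0
  · subst hc
    intro x y hy
    have hx : f x ≠ 0 := by
      intro h
      simp [h] at hy
    filter_upwards [hf.continuousAt.eventually_ne hx] with z hz
    have hy' : y < f x / 0 := hy
    change y < f z / 0
    rw [ENNReal.div_zero hx] at hy'
    rwa [ENNReal.div_zero hz]
  · exact ((ENNReal.continuous_div_const c hc).comp hf).lowerSemicontinuous

lemma lowerSemicontinuous_chiForm (σ : Matrix (Fin D) (Fin D) ℂ)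
    (E : ι → Matrix (Fin D) (Fin D) ℂ) : LowerSemicontinuous (chiForm σ E) := by
  refine lowerSemicontinuous_sum fun i _ => lowerSemicontinuous_div_const ?_ _
  refine ENNReal.continuous_ofReal.comp (Continuous.pow ?_ 2)
  exact Complex.continuous_re.comp (by fun_prop)

lemma exists_eq_iInf {α β : Type*} [TopologicalSpace α] [CompleteLinearOrder β] {s : Set α}
    (hs : s.Nonempty) (hc : IsCompact s) {f : α → β} (hf : LowerSemicontinuous f) :
    ∃ x ∈ s, f x = ⨅ y ∈ s, f y := by
  obtain ⟨x, hx, hmin⟩ := (hf.lowerSemicontinuousOn s).exists_isMinOn hs hc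
  exact ⟨x, hx, le_antisymm (le_iInf₂ fun y hy => hmin hy) (iInf₂_le x hx)⟩

lemma exists_eq_povmDirRate (h : (directions D).Nonempty) (σ : Matrix (Fin D) (Fin D) ℂ)
    (E : ι → Matrix (Fin D) (Fin D) ℂ) :
    ∃ X ∈ directions D, chiForm σ E X = povmDirRate σ E :=
  exists_eq_iInf h isCompact_directions (lowerSemicontinuous_chiForm σ E)

lemma exists_eq_povmRate {ε : ℝ} (h : (alternatives σ ε).Nonempty)
    (E : ι → Matrix (Fin D) (Fin D) ℂ) :
    ∃ ρ ∈ alternatives σ ε,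
      chiSq (born E σ) (born E ρ) / ENNReal.ofReal (ε ^ 2) = povmRate σ ε E := by
  have hf : LowerSemicontinuous fun ρ => chiSq (born E σ) (born E ρ) := by
    simp only [chiSq_eq_chiForm]
    exact (lowerSemicontinuous_chiForm σ E).comp (by fun_prop)
  obtain ⟨ρ, hρ, h1⟩ := exists_eq_iInf h (isCompact_alternatives σ ε) hf
  exact ⟨ρ, hρ, by rw [h1, povmRate]⟩

/-- A lower bound on the form bounds the directional rate from below. -/
lemma le_povmDirRate {ξ : ℝ} (h : ∀ X : Matrix (Fin D) (Fin D) ℂ, X.IsHermitian → X.trace = 0 →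
    ENNReal.ofReal (ξ * frobNorm X ^ 2) ≤ chiForm σ E X) :
    ENNReal.ofReal ξ ≤ povmDirRate σ E := by
  refine le_iInf₂ fun X hX => ?_
  have := h X hX.1 hX.2.1
  rwa [hX.2.2, one_pow, mul_one] at this

/-- A lower bound on the form bounds the rate from below. -/
lemma le_povmRate (hσ : IsState σ) {ξ ε : ℝ} (hξ : 0 ≤ ξ) (hε : 0 < ε)
    (h : ∀ X : Matrix (Fin D) (Fin D) ℂ, X.IsHermitian → X.trace = 0 →
      ENNReal.ofReal (ξ * frobNorm X ^ 2) ≤ chiForm σ E X) :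
    ENNReal.ofReal ξ ≤ povmRate σ ε E := by
  have he : ENNReal.ofReal (ε ^ 2) ≠ 0 := (ENNReal.ofReal_pos.2 (by positivity)).ne'
  rw [povmRate, ENNReal.le_div_iff_mul_le (Or.inl he) (Or.inl ENNReal.ofReal_ne_top),
    ← ENNReal.ofReal_mul hξ]
  refine le_iInf₂ fun ρ hρ => ?_
  rw [chiSq_eq_chiForm]
  refine le_trans (ENNReal.ofReal_le_ofReal ?_) (h (ρ - σ) (hρ.1.1.1.sub hσ.1.1) ?_)
  · exact mul_le_mul_of_nonneg_left (pow_le_pow_left₀ hε.le hρ.2 2) hξ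
  · rw [trace_sub, hρ.1.2, hσ.2, sub_self]

/-- A direction in which one can move by `ε` bounds the rate from above. -/
lemma povmRate_le {X : Matrix (Fin D) (Fin D) ℂ} (hX : frobNorm X = 1) {ε : ℝ} (hε : 0 < ε)
    (hst : IsState (σ + (ε : ℂ) • X)) : σ + (ε : ℂ) • X ∈ alternatives σ ε ∧
      povmRate σ ε E ≤ chiForm σ E X := by
  have he : ENNReal.ofReal (ε ^ 2) ≠ 0 := (ENNReal.ofReal_pos.2 (by positivity)).ne'
  have hmem : σ + (ε : ℂ) • X ∈ alternatives σ ε := by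
    refine ⟨hst, ?_⟩
    rw [add_sub_cancel_left, frobNorm_smul hε.le, hX, mul_one]
  refine ⟨hmem, ?_⟩
  rw [povmRate, ENNReal.div_le_iff he ENNReal.ofReal_ne_top]
  refine (iInf₂_le _ hmem).trans ?_
  rw [chiSq_eq_chiForm, add_sub_cancel_left, chiForm_smul, mul_comm]

variable {κ : Type*} [Fintype κ]

lemma isPOVM_comp_equiv (e : κ ≃ ι) (h : IsPOVM E) : IsPOVM (E ∘ e) :=
  ⟨fun i => h.1 (e i), by rw [← h.2]; exact e.sum_comp E⟩

lemma chiForm_comp_equiv (e : κ ≃ ι) (σ X : Matrix (Fin D) (Fin D) ℂ)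
    (E : ι → Matrix (Fin D) (Fin D) ℂ) : chiForm σ (E ∘ e) X = chiForm σ E X :=
  e.sum_comp fun i => ENNReal.ofReal (born E X i ^ 2) / ENNReal.ofReal (born E σ i)

lemma povmDirRate_comp_equiv (e : κ ≃ ι) (σ : Matrix (Fin D) (Fin D) ℂ)
    (E : ι → Matrix (Fin D) (Fin D) ℂ) : povmDirRate σ (E ∘ e) = povmDirRate σ E := by
  simp only [povmDirRate, chiForm_comp_equiv]

lemma povmRate_comp_equiv (e : κ ≃ ι) (σ : Matrix (Fin D) (Fin D) ℂ) (ε : ℝ)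
    (E : ι → Matrix (Fin D) (Fin D) ℂ) : povmRate σ ε (E ∘ e) = povmRate σ ε E := by
  simp only [povmRate, chiSq_eq_chiForm, chiForm_comp_equiv]

/-- A POVM, with outcomes in any finite set, that reaches an upper bound on all directional rates
attains the maximum. -/
lemma dirDivergenceRate_eq {x : ℝ≥0∞} (hE : IsPOVM E) (hx : x ≤ povmDirRate σ E)
    (hle : ∀ (r : ℕ) (F : Fin r → Matrix (Fin D) (Fin D) ℂ), IsPOVM F → povmDirRate σ F ≤ x) :
    dirDivergenceRate σ = x ∧ povmDirRate σ E = x ∧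
      ∃ (r : ℕ) (F : Fin r → Matrix (Fin D) (Fin D) ℂ), IsPOVM F ∧
        povmDirRate σ F = dirDivergenceRate σ := by
  -- The maximum ranges over outcome sets `Fin r` only, so a POVM with other labels has to be
  -- relabelled.
  have e := (Fintype.equivFin ι).symm
  have h1 := povmDirRate_comp_equiv e σ E
  have h2 := isPOVM_comp_equiv e hE
  have h3 : povmDirRate σ E = x := le_antisymm (h1 ▸ hle _ _ h2) hx
  have h4 : dirDivergenceRate σ = x := by
    refine le_antisymm (iSup_le fun r => iSup₂_le fun F hF => hle r F hF) ?_
    rw [← h3, ← h1]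
    exact le_iSup_of_le _ (le_iSup₂_of_le _ h2 le_rfl)
  exact ⟨h4, h3, _, _, h2, by rw [h1, h3, h4]⟩

/-- A POVM, with outcomes in any finite set, that reaches an upper bound on all rates attains the
maximum. -/
lemma divergenceRate_eq {x : ℝ≥0∞} {ε : ℝ} (hE : IsPOVM E) (hx : x ≤ povmRate σ ε E)
    (hle : ∀ (r : ℕ) (F : Fin r → Matrix (Fin D) (Fin D) ℂ), IsPOVM F → povmRate σ ε F ≤ x) :
    divergenceRate σ ε = x ∧ povmRate σ ε E = x ∧
      ∃ (r : ℕ) (F : Fin r → Matrix (Fin D) (Fin D) ℂ), IsPOVM F ∧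
        povmRate σ ε F = divergenceRate σ ε := by
  have e := (Fintype.equivFin ι).symm
  have h1 := povmRate_comp_equiv e σ ε E
  have h2 := isPOVM_comp_equiv e hE
  have h3 : povmRate σ ε E = x := le_antisymm (h1 ▸ hle _ _ h2) hx
  have h4 : divergenceRate σ ε = x := by
    refine le_antisymm (iSup_le fun r => iSup₂_le fun F hF => hle r F hF) ?_
    rw [← h3, ← h1]
    exact le_iSup_of_le _ (le_iSup₂_of_le _ h2 le_rfl)
  exact ⟨h4, h3, _, _, h2, by rw [h1, h3, h4]⟩

end Rates

/-! ### The upper bound, valid for every POVM. -/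

section UpperBound

variable {D : ℕ}

/-- The direction `(w |j⟩⟨k| + w̄ |k⟩⟨j|) / √2`. -/
noncomputable def pairDir (j k : Fin D) (w : ℂ) : Matrix (Fin D) (Fin D) ℂ :=
  ((1 / Real.sqrt 2 : ℝ) : ℂ) • (single j k w + single k j (star w))

lemma pairDir_apply_ne_zero {j k : Fin D} {w : ℂ} {a c : Fin D} (h : pairDir j k w a c ≠ 0) :
    (a = j ∧ c = k) ∨ (a = k ∧ c = j) := by
  by_contra hne
  push Not at hne
  apply h
  simp only [pairDir, Matrix.smul_apply, Matrix.add_apply, single_apply]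
  rw [if_neg (by grind), if_neg (by grind)]
  simp

lemma pairDir_mem_directions {j k : Fin D} (hjk : j ≠ k) {w : ℂ} (hw : ‖w‖ = 1) :
    pairDir j k w ∈ directions D := by
  refine ⟨?_, ?_, ?_⟩
  · rw [IsHermitian, pairDir, conjTranspose_smul, conjTranspose_add, conjTranspose_single,
      conjTranspose_single, star_star, add_comm]
    simp
  · simp [pairDir, trace_single_eq_of_ne, hjk, hjk.symm]
  · rw [frobNorm_eq_iff zero_le_one]
    have h : ∀ a c, ‖pairDir j k w a c‖ ^ 2 =
        (if a = j then (if c = k then (1 / 2 : ℝ) else 0) else 0) +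
        (if a = k then (if c = j then (1 / 2 : ℝ) else 0) else 0) := by
      intro a c
      have h2 : (Real.sqrt 2) ^ 2 = 2 := Real.sq_sqrt (by norm_num)
      have h3 : ‖((1 / Real.sqrt 2 : ℝ) : ℂ)‖ ^ 2 = 1 / 2 := by
        rw [Complex.norm_real, Real.norm_eq_abs, sq_abs, div_pow, h2, one_pow]
      simp only [pairDir, Matrix.smul_apply, Matrix.add_apply, single_apply, smul_eq_mul, norm_mul, mul_pow, h3]
      by_cases h1 : a = j ∧ c = k
      · obtain ⟨rfl, rfl⟩ := h1
        simp [hjk, hjk.symm, hw]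
      · by_cases h4 : a = k ∧ c = j
        · obtain ⟨rfl, rfl⟩ := h4
          simp [hjk, hjk.symm, hw]
        · rw [if_neg (by grind), if_neg (by grind)]
          have e1 : (if a = j then (if c = k then (1 / 2 : ℝ) else 0) else 0) = 0 := by
            split_ifs <;> simp_all
          have e2 : (if a = k then (if c = j then (1 / 2 : ℝ) else 0) else 0) = 0 := by
            split_ifs <;> simp_all
          rw [e1, e2]
          simp
    simp only [h, Finset.sum_add_distrib]
    simp
    norm_num

lemma diagonal_mem_directions {v : Fin D → ℝ} (h0 : ∑ k, v k = 0) (h1 : ∑ k, v k ^ 2 = 1) :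
    (diagonal fun k => ((v k : ℝ) : ℂ)) ∈ directions D := by
  refine ⟨?_, ?_, ?_⟩
  · rw [IsHermitian, diagonal_conjTranspose]
    congr 1
    ext k
    simp
  · rw [trace_diagonal, ← Complex.ofReal_sum, h0, Complex.ofReal_zero]
  · rw [frobNorm_eq_iff zero_le_one, one_pow, ← h1]
    refine Finset.sum_congr rfl fun a _ => ?_
    rw [Finset.sum_eq_single a]
    · simp
    · intro c _ hc
      simp [diagonal_apply_ne' _ hc]
    · simp

/-- Lagrange's form of the Cauchy-Schwarz defect. It is used with weights `λ_k ⟨k|E_i|k⟩` for each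
outcome and once more with weights `λ_k`. -/
lemma lagrange_sum {κ : Type*} [Fintype κ] (w u : κ → ℝ) :
    (∑ k, w k * u k) ^ 2 + 1 / 2 * ∑ j, ∑ k, w j * w k * (u j - u k) ^ 2 =
      (∑ k, w k) * ∑ k, w k * u k ^ 2 := by
  have h : ∑ j, ∑ k, w j * w k * (u j - u k) ^ 2 =
      2 * ((∑ k, w k) * ∑ k, w k * u k ^ 2) - 2 * (∑ k, w k * u k) ^ 2 := by
    have e1 : ∀ j, ∑ k, w j * w k * (u j - u k) ^ 2 = w j * u j ^ 2 * (∑ k, w k) -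
        2 * (w j * u j) * (∑ k, w k * u k) + w j * ∑ k, w k * u k ^ 2 := by
      intro j
      simp only [Finset.mul_sum, ← Finset.sum_sub_distrib, ← Finset.sum_add_distrib]
      exact Finset.sum_congr rfl fun k _ => by ring
    simp only [e1, Finset.sum_add_distrib, Finset.sum_sub_distrib, ← Finset.sum_mul,
      ← Finset.mul_sum]
    ring
  rw [h]
  ring

variable {ι : Type*} [Fintype ι] {E : ι → Matrix (Fin D) (Fin D) ℂ} {lam : Fin D → ℝ}

lemma sum_diag_re_of_isPOVM (hE : IsPOVM E) (k : Fin D) : ∑ i, (E i k k).re = 1 := by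
  have := congrArg (fun A : Matrix (Fin D) (Fin D) ℂ => (A k k).re) hE.2
  simpa [Matrix.sum_apply] using this

lemma diag_re_nonneg (hE : IsPOVM E) (i : ι) (k : Fin D) : 0 ≤ (E i k k).re :=
  (Complex.nonneg_iff.1 ((hE.1 i).diag_nonneg (i := k))).1

lemma born_diagonal {κ : Type*} (E : κ → Matrix (Fin D) (Fin D) ℂ) (v : Fin D → ℝ) (i : κ) :
    born E (diagonal fun k => (v k : ℂ)) i = ∑ k, v k * (E i k k).re := by
  simp [born, trace, mul_diagonal, mul_comm]

lemma born_diagonal_nonneg (hE : IsPOVM E) (hnn : ∀ k, 0 ≤ lam k) (i : ι) :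
    0 ≤ born E (diagonal fun k => (lam k : ℂ)) i := by
  rw [born_diagonal]
  exact Finset.sum_nonneg fun k _ => mul_nonneg (hnn k) (diag_re_nonneg hE i k)

lemma mul_diag_re_eq_zero (hE : IsPOVM E) (hnn : ∀ k, 0 ≤ lam k) {i : ι}
    (h : born E (diagonal fun k => (lam k : ℂ)) i = 0) (k : Fin D) :
    lam k * (E i k k).re = 0 := by
  rw [born_diagonal] at h
  exact (Finset.sum_eq_zero_iff_of_nonneg fun k _ =>
    mul_nonneg (hnn k) (diag_re_nonneg hE i k)).1 h k (Finset.mem_univ k)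

lemma born_pairDir (hE : IsPOVM E) (j k : Fin D) (w : ℂ) (i : ι) :
    born E (pairDir j k w) i = Real.sqrt 2 * (w * E i k j).re := by
  have h1 : E i j k = star (E i k j) := ((hE.1 i).1.apply j k).symm
  have h2 : (1 / Real.sqrt 2) * 2 = Real.sqrt 2 := by
    rw [div_mul_eq_mul_div, one_mul, Real.div_sqrt]
  rw [born, pairDir, Matrix.mul_smul, trace_smul, Matrix.mul_add, trace_add, trace_mul_single,
    trace_mul_single, h1, smul_eq_mul, Complex.re_ofReal_mul]
  simp only [op_smul_eq_mul, Complex.star_def, Complex.add_re, Complex.mul_re,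
    Complex.conj_re, Complex.conj_im]
  nth_rw 2 [← h2]
  ring

/-- Along one of the coherences between `j` and `k` the form is at most
`∑_i ⟨j|E_i|j⟩ ⟨k|E_i|k⟩ / p_i`. -/
lemma exists_pairDir_le (hE : IsPOVM E) (hnn : ∀ k, 0 ≤ lam k) {j : Fin D} (hj : lam j ≠ 0)
    (k : Fin D) : ∃ w : ℂ, ‖w‖ = 1 ∧
      chiForm (diagonal fun k => (lam k : ℂ)) E (pairDir j k w) ≤
        ENNReal.ofReal (∑ i, (E i j j).re * (E i k k).re /
          born E (diagonal fun k => (lam k : ℂ)) i) := by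
  set p := born E (diagonal fun k => (lam k : ℂ)) with hp
  have hp0 : ∀ i, 0 ≤ p i := born_diagonal_nonneg hE hnn
  have hval : ∀ w, chiForm (diagonal fun k => (lam k : ℂ)) E (pairDir j k w) =
      ENNReal.ofReal (∑ i, 2 * (w * E i k j).re ^ 2 / p i) := by
    intro w
    rw [chiForm_eq_ofReal hp0]
    · congr 1
      refine Finset.sum_congr rfl fun i _ => ?_
      rw [born_pairDir hE, mul_pow, Real.sq_sqrt (by norm_num)]
    · intro i hi
      -- An impossible outcome has `⟨j|E_i|j⟩ = 0` because `λ_j ≠ 0`, and Cauchy-Schwarz then kills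
      -- the coherence. Nothing is needed of `λ_k`, so `k` may lie in the kernel, as the pure case
      -- requires.
      have h1 := (mul_eq_zero.1 (mul_diag_re_eq_zero hE hnn hi j)).resolve_left hj
      have h2 := norm_sq_entry_le (hE.1 i) k j
      rw [h1, mul_zero] at h2
      have h3 : E i k j = 0 := norm_eq_zero.1 (pow_eq_zero_iff two_ne_zero |>.1
        (le_antisymm h2 (sq_nonneg _)))
      rw [born_pairDir hE, h3]
      simp
  -- The directions `w = 1` and `w = i` see the real and the imaginary part of the same entry. Their
  -- sum involves `|⟨k|E_i|j⟩|² ≤ ⟨k|E_i|k⟩⟨j|E_i|j⟩`, and the smaller one is at most the average.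
  have hsum : (∑ i, 2 * (1 * E i k j).re ^ 2 / p i) +
      (∑ i, 2 * (Complex.I * E i k j).re ^ 2 / p i) ≤
        2 * ∑ i, (E i j j).re * (E i k k).re / p i := by
    rw [← Finset.sum_add_distrib, Finset.mul_sum]
    refine Finset.sum_le_sum fun i _ => ?_
    rw [← add_div, ← mul_div_assoc]
    refine div_le_div_of_nonneg_right ?_ (hp0 i)
    have h2 := norm_sq_entry_le (hE.1 i) k j
    rw [Complex.sq_norm, Complex.normSq_apply] at h2
    simp only [one_mul, Complex.mul_re, Complex.I_re, Complex.I_im, zero_mul, zero_sub, neg_sq]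
    linarith
  by_cases h : (∑ i, 2 * (1 * E i k j).re ^ 2 / p i) ≤ ∑ i, (E i j j).re * (E i k k).re / p i
  · exact ⟨1, norm_one, (hval 1).trans_le (ENNReal.ofReal_le_ofReal h)⟩
  · exact ⟨Complex.I, Complex.norm_I, (hval _).trans_le (ENNReal.ofReal_le_ofReal (by linarith))⟩

/-- No POVM does better than `1 / (1 + μ)` in all directions on the support. -/
theorem exists_direction_chiForm_le (hE : IsPOVM E) (hnn : ∀ k, 0 ≤ lam k)
    (hlam : ∑ k, lam k = 1) {μ : ℝ} (hμ : 0 < μ) {u : Fin D → ℝ} (hu0 : ∑ k, lam k * u k = 0)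
    (hu1 : ∑ k, (lam k * u k) ^ 2 = 1) (hu2 : ∑ k, lam k * u k ^ 2 = 1 / μ) :
    ∃ X ∈ directions D, (∀ a c, X a c ≠ 0 → lam a ≠ 0 ∧ lam c ≠ 0) ∧
      chiForm (diagonal fun k => (lam k : ℂ)) E X ≤ ENNReal.ofReal (1 / (1 + μ)) := by
  set p := born E (diagonal fun k => (lam k : ℂ)) with hp
  have hp0 : ∀ i, 0 ≤ p i := born_diagonal_nonneg hE hnn
  set ξ := 1 / (1 + μ) with hξ
  have hξ0 : 0 ≤ ξ := by positivity
  by_contra hcon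
  push Not at hcon
  have hdiag : ξ < ∑ i, (∑ k, lam k * u k * (E i k k).re) ^ 2 / p i := by
    have h1 := hcon _ (diagonal_mem_directions hu0 hu1) (by
      intro a c hac
      by_cases h : a = c
      · subst h
        have : lam a ≠ 0 := by
          intro h
          simp [h] at hac
        exact ⟨this, this⟩
      · exact absurd (diagonal_apply_ne _ h) hac)
    rw [chiForm_eq_ofReal hp0, ENNReal.ofReal_lt_ofReal_iff_of_nonneg hξ0] at h1
    · simpa only [born_diagonal E fun k => lam k * u k] using h1
    · intro i hi
      rw [born_diagonal]
      refine Finset.sum_eq_zero fun k _ => ?_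
      rw [mul_right_comm, mul_diag_re_eq_zero hE hnn hi k, zero_mul]
  -- The weight vanishes unless `j ≠ k` both lie in the support, so only coherences on the support
  -- need to be tested.
  have hoff : ∀ j k, lam j * lam k * (u j - u k) ^ 2 * ξ ≤
      lam j * lam k * (u j - u k) ^ 2 * ∑ i, (E i j j).re * (E i k k).re / p i := by
    intro j k
    by_cases hjk : j = k
    · simp [hjk]
    by_cases hj : lam j = 0
    · simp [hj]
    by_cases hk : lam k = 0
    · simp [hk]
    refine mul_le_mul_of_nonneg_left ?_
      (mul_nonneg (mul_nonneg (hnn j) (hnn k)) (sq_nonneg _))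
    obtain ⟨w, hw, hle⟩ := exists_pairDir_le hE hnn hj k
    have h1 := (hcon _ (pairDir_mem_directions hjk hw) (by
      intro a c hac
      rcases pairDir_apply_ne_zero hac with ⟨rfl, rfl⟩ | ⟨rfl, rfl⟩
      · exact ⟨hj, hk⟩
      · exact ⟨hk, hj⟩)).trans_le hle
    exact ((ENNReal.ofReal_lt_ofReal_iff_of_nonneg hξ0).1 h1).le
  have hid : ∑ i, (∑ k, lam k * u k * (E i k k).re) ^ 2 / p i +
      1 / 2 * ∑ j, ∑ k, lam j * lam k * (u j - u k) ^ 2 *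
        ∑ i, (E i j j).re * (E i k k).re / p i = 1 / μ := by
    have h1 : ∀ i, (∑ k, lam k * u k * (E i k k).re) ^ 2 / p i +
        1 / 2 * ∑ j, ∑ k, lam j * lam k * (u j - u k) ^ 2 *
          ((E i j j).re * (E i k k).re / p i) = ∑ k, lam k * u k ^ 2 * (E i k k).re := by
      intro i
      -- For an impossible outcome the left side is zero by the convention for real division by
      -- zero, and the right side because each `λ_k ⟨k|E_i|k⟩` vanishes.
      by_cases hi : p i = 0
      · have : ∀ k, lam k * u k ^ 2 * (E i k k).re = 0 := fun k => by
          rw [mul_right_comm, mul_diag_re_eq_zero hE hnn hi k, zero_mul]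
        simp [hi, this]
      · have h2 := lagrange_sum (fun k => lam k * (E i k k).re) u
        rw [← born_diagonal, ← hp] at h2
        have h3 : ∑ k, lam k * u k ^ 2 * (E i k k).re =
            (p i * ∑ k, lam k * (E i k k).re * u k ^ 2) / p i := by
          rw [mul_div_cancel_left₀ _ hi]
          exact Finset.sum_congr rfl fun k _ => by ring
        rw [h3, ← h2, add_div, mul_div_assoc, Finset.sum_div]
        simp only [Finset.sum_div]
        congr 1
        · congr 2
          exact Finset.sum_congr rfl fun k _ => by ring
        · congr 1
          exact Finset.sum_congr rfl fun j _ => Finset.sum_congr rfl fun k _ => by ring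
    have h2 : ∑ i, (1 / 2 * ∑ j, ∑ k, lam j * lam k * (u j - u k) ^ 2 *
          ((E i j j).re * (E i k k).re / p i)) =
        1 / 2 * ∑ j, ∑ k, lam j * lam k * (u j - u k) ^ 2 *
          ∑ i, (E i j j).re * (E i k k).re / p i := by
      rw [← Finset.mul_sum, Finset.sum_comm]
      congr 1
      refine Finset.sum_congr rfl fun j _ => ?_
      rw [Finset.sum_comm]
      exact Finset.sum_congr rfl fun k _ => (Finset.mul_sum _ _ _).symm
    rw [← h2, ← Finset.sum_add_distrib, Finset.sum_congr rfl fun i _ => h1 i, Finset.sum_comm,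
      ← hu2]
    refine Finset.sum_congr rfl fun k _ => ?_
    rw [← Finset.mul_sum, sum_diag_re_of_isPOVM hE, mul_one]
  have hY := lagrange_sum lam u
  rw [hu0, hlam, hu2] at hY
  have hle : ξ * (1 / 2 * ∑ j, ∑ k, lam j * lam k * (u j - u k) ^ 2) ≤
      1 / 2 * ∑ j, ∑ k, lam j * lam k * (u j - u k) ^ 2 *
        ∑ i, (E i j j).re * (E i k k).re / p i := by
    rw [mul_left_comm, mul_comm ξ, Finset.sum_mul]
    simp only [Finset.sum_mul]
    exact mul_le_mul_of_nonneg_left (Finset.sum_le_sum fun j _ => Finset.sum_le_sum fun k _ =>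
      hoff j k) (by norm_num)
  -- This balance determines `ξ`: total weight `1 + 1/μ` against total value `1/μ`.
  have hfin : ξ + ξ * (1 / μ) = 1 / μ := by
    rw [hξ]; field_simp; ring
  have hY' : 1 / 2 * ∑ j, ∑ k, lam j * lam k * (u j - u k) ^ 2 = 1 / μ := by linarith
  rw [hY'] at hle
  linarith

/-- For a pure state no POVM does better than `1`. -/
theorem exists_direction_chiForm_le_one (hE : IsPOVM E) {k₀ l : Fin D} (hl : k₀ ≠ l) :
    ∃ X ∈ directions D,
      chiForm (diagonal fun k => ((Pi.single k₀ 1 : Fin D → ℝ) k : ℂ)) E X ≤ 1 := by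
  have hnn : ∀ k, 0 ≤ (Pi.single k₀ 1 : Fin D → ℝ) k := fun k => by
    rw [Pi.single_apply]; split_ifs <;> norm_num
  -- The direction is a coherence from the support to the kernel. As `p_i = ⟨k₀|E_i|k₀⟩` cancels,
  -- the bound is at most `∑ ⟨l|E_i|l⟩ = 1`.
  obtain ⟨w, hw, hle⟩ := exists_pairDir_le hE hnn (j := k₀) (by simp) l
  refine ⟨_, pairDir_mem_directions hl hw, hle.trans ?_⟩
  rw [← ENNReal.ofReal_one]
  refine ENNReal.ofReal_le_ofReal (le_of_le_of_eq ?_ (sum_diag_re_of_isPOVM hE l))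
  refine (Finset.sum_le_sum fun i _ => ?_)
  have : born E (diagonal fun k => ((Pi.single k₀ 1 : Fin D → ℝ) k : ℂ)) i = (E i k₀ k₀).re := by
    rw [born_diagonal]
    simp [Pi.single_apply]
  rw [this]
  by_cases h : (E i k₀ k₀).re = 0
  · rw [h, zero_mul, zero_div]
    exact diag_re_nonneg hE i l
  · rw [mul_div_cancel_left₀ _ h]

/-- Moving by `ε` along a direction on the part of the spectrum above `ε` gives a state. -/
lemma isState_diagonal_add_smul (hnn : ∀ k, 0 ≤ lam k) (hlam : ∑ k, lam k = 1) {ε : ℝ}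
    (hε : 0 ≤ ε) {X : Matrix (Fin D) (Fin D) ℂ} (hX : X ∈ directions D)
    (hsupp : ∀ a c, X a c ≠ 0 → ε ≤ lam a ∧ ε ≤ lam c) :
    IsState ((diagonal fun k => (lam k : ℂ)) + (ε : ℂ) • X) := by
  obtain ⟨hH, htr, hF⟩ := hX
  refine ⟨?_, ?_⟩
  swap
  · rw [trace_add, trace_smul, htr, smul_zero, add_zero, trace_diagonal, ← Complex.ofReal_sum,
      hlam, Complex.ofReal_one]
  have hherm : ((diagonal fun k => (lam k : ℂ)) + (ε : ℂ) • X).IsHermitian := by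
    refine IsHermitian.add ?_ ?_
    · rw [IsHermitian, diagonal_conjTranspose]
      congr 1
      ext k
      simp
    · rw [IsHermitian, conjTranspose_smul, hH]
      simp
  refine posSemidef_iff_dotProduct_mulVec.2 ⟨hherm, fun x => ?_⟩
  have him := hherm.im_star_dotProduct_mulVec_self x
  rw [Complex.nonneg_iff]
  refine ⟨?_, by simpa using him.symm⟩
  -- Only the block of `P` meets `X`. There the diagonal part gives at least `ε n`, while
  -- Cauchy-Schwarz over pairs and `‖X‖ = 1` give `|⟨x|X|x⟩| ≤ n`.
  set P : Finset (Fin D) := Finset.univ.filter fun a => ε ≤ lam a with hP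
  set n : ℝ := ∑ a ∈ P, ‖x a‖ ^ 2 with hn
  have hn0 : 0 ≤ n := Finset.sum_nonneg fun a _ => sq_nonneg _
  have hdiag : ε * n ≤ (star x ⬝ᵥ (diagonal fun k => (lam k : ℂ)) *ᵥ x).re := by
    have : (star x ⬝ᵥ (diagonal fun k => (lam k : ℂ)) *ᵥ x).re = ∑ a, lam a * ‖x a‖ ^ 2 := by
      simp only [dotProduct, mulVec_diagonal, Complex.re_sum, Pi.star_apply]
      refine Finset.sum_congr rfl fun a _ => ?_
      rw [Complex.sq_norm, Complex.normSq_apply]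
      simp
      ring
    rw [this, hn, Finset.mul_sum]
    refine (Finset.sum_le_sum fun a ha => mul_le_mul_of_nonneg_right
      (Finset.mem_filter.1 ha).2 (sq_nonneg _)).trans ?_
    exact Finset.sum_le_sum_of_subset_of_nonneg (Finset.subset_univ _)
      fun a _ _ => mul_nonneg (hnn a) (sq_nonneg _)
  have hoff : ‖star x ⬝ᵥ X *ᵥ x‖ ≤ n := by
    have h1 : star x ⬝ᵥ X *ᵥ x = ∑ q ∈ P ×ˢ P, star (x q.1) * (X q.1 q.2 * x q.2) := by
      rw [Finset.sum_product]
      simp only [dotProduct, mulVec, Finset.mul_sum, Pi.star_apply]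
      symm
      rw [Finset.sum_subset (Finset.subset_univ P)]
      · refine Finset.sum_congr rfl fun a _ => Finset.sum_subset (Finset.subset_univ P) ?_
        intro c _ hc
        by_cases h : X a c = 0
        · simp [h]
        · exact absurd (by simp [hP, (hsupp a c h).2]) hc
      · intro a _ ha
        refine Finset.sum_eq_zero fun c _ => ?_
        by_cases h : X a c = 0
        · simp [h]
        · exact absurd (by simp [hP, (hsupp a c h).1]) ha
    have h2 : ‖star x ⬝ᵥ X *ᵥ x‖ ≤ ∑ q ∈ P ×ˢ P, ‖X q.1 q.2‖ * (‖x q.1‖ * ‖x q.2‖) := by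
      rw [h1]
      refine (norm_sum_le _ _).trans (Finset.sum_le_sum fun q _ => le_of_eq ?_)
      simp only [norm_mul, norm_star]
      ring
    have h3 := Finset.sum_mul_sq_le_sq_mul_sq (P ×ˢ P) (fun q => ‖X q.1 q.2‖)
      fun q => ‖x q.1‖ * ‖x q.2‖
    have h4 : ∑ q ∈ P ×ˢ P, ‖X q.1 q.2‖ ^ 2 ≤ 1 := by
      have h5 := frobNorm_sq X
      rw [hF, one_pow, ← Finset.sum_product'] at h5
      rw [h5]
      exact Finset.sum_le_sum_of_subset_of_nonneg (by simp) fun q _ _ => sq_nonneg _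
    have h6 : ∑ q ∈ P ×ˢ P, (‖x q.1‖ * ‖x q.2‖) ^ 2 = n ^ 2 := by
      rw [Finset.sum_product, sq, hn, Finset.sum_mul_sum]
      simp only [mul_pow]
    rw [h6] at h3
    refine h2.trans (abs_le_of_sq_le_sq' ?_ hn0).2
    exact h3.trans (mul_le_of_le_one_left (sq_nonneg n) h4)
  have hre := (abs_le.1 ((Complex.abs_re_le_norm _).trans hoff)).1
  rw [add_mulVec, dotProduct_add, smul_mulVec, dotProduct_smul, Complex.add_re, smul_eq_mul,
    Complex.re_ofReal_mul]
  nlinarith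

end UpperBound

/-! ### Fourth moments of phase vectors. -/

section PhaseMoments

variable {D : ℕ} {J : Type*} [Fintype J]

/-- Fourth moments of a family of phase vectors: only the trivial ones survive. -/
def HasPhaseMoments (z : J → Fin D → ℂ) : Prop :=
  ∀ k l a c : Fin D, ∑ j, star (z j k) * z j l * (z j a * star (z j c)) =
    if (k = a ∧ l = c) ∨ (k = l ∧ a = c) then (Fintype.card J : ℂ) else 0

/-- The phases `i` at the index `k₀` and `1` elsewhere. -/
noncomputable def quarterTurn (k₀ : Fin D) : Fin D → ℂ := fun k => if k = k₀ then Complex.I else 1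

/-- Invariance under quarter turns of single phases determines the fourth moments. -/
lemma hasPhaseMoments_of_quarterTurn {z : J → Fin D → ℂ} (hz : ∀ j k, star (z j k) * z j k = 1)
    (h : ∀ k₀ k l a c : Fin D, quarterTurn k₀ k * star (quarterTurn k₀ l) *
        ∑ j, star (z j k) * z j l * (z j a * star (z j c)) =
      quarterTurn k₀ a * star (quarterTurn k₀ c) *
        ∑ j, star (z j k) * z j l * (z j a * star (z j c))) :
    HasPhaseMoments z := by
  intro k l a c
  have hI : Complex.I ≠ 1 := fun h => by simpa using congrArg Complex.re h
  have hI' : -Complex.I ≠ 1 := fun h => by simpa using congrArg Complex.re h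
  have hI2 : Complex.I ≠ -Complex.I := fun h => by
    have := congrArg Complex.im h
    norm_num at this
  have key : ∀ {α β M : ℂ}, α * M = β * M → α ≠ β → M = 0 := by
    intro α β M h1 h2
    by_contra h0
    exact h2 (mul_right_cancel₀ h0 h1)
  split_ifs with hc
  · have : ∀ j, star (z j k) * z j l * (z j a * star (z j c)) = 1 := by
      intro j
      rcases hc with ⟨rfl, rfl⟩ | ⟨rfl, rfl⟩
      · calc _ = (star (z j k) * z j k) * (star (z j l) * z j l) := by ring
          _ = 1 := by rw [hz, hz, one_mul]
      · rw [hz, mul_comm (z j a), hz, one_mul]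
    simp only [this]
    simp
  · push Not at hc
    by_cases hkl : k = l
    · have hac := hc.2 hkl
      refine key (h a k l a c) ?_
      subst hkl
      by_cases hka : k = a
      · simp [quarterTurn, hka, hac.symm, hI.symm]
      · simp [quarterTurn, hka, hac.symm, hI.symm]
    · by_cases hka : k = a
      · have hlc := hc.1 hka
        refine key (h l k l a c) ?_
        subst hka
        simp [quarterTurn, hkl, Ne.symm hlc, hI']
      -- Sign flips would not suffice here: for `c = k` the two sides acquire `i` and its conjugate,
      -- which differ, whereas `-1` is real.
      · refine key (h k k l a c) ?_
        by_cases hck : c = k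
        · simp [quarterTurn, Ne.symm hkl, Ne.symm hka, hck, hI2]
        · simp [quarterTurn, Ne.symm hkl, Ne.symm hka, hck, hI]

/-- The family of all vectors of fourth roots of unity has trivial fourth moments. -/
lemma exists_hasPhaseMoments (D : ℕ) :
    ∃ (m : ℕ) (θ : Fin m → Fin D → ℝ), 0 < m ∧ HasPhaseMoments fun j => phases (θ j) := by
  let φ : (Fin D → ZMod 4) → Fin D → ℝ := fun f k => Real.pi / 2 * ((f k).val : ℝ)
  have hφ : ∀ f k, phases (φ f) k = Complex.I ^ (f k).val := by
    intro f k
    have h1 : Complex.exp (Complex.I * (Real.pi / 2)) = Complex.I := by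
      rw [mul_comm, Complex.exp_mul_I]
      simp
    rw [phases, ← h1, ← Complex.exp_nat_mul]
    congr 1
    simp only [φ]
    push_cast
    rw [h1]
    ring
  have hsucc : ∀ x : ZMod 4, Complex.I ^ (x + 1).val = Complex.I * Complex.I ^ x.val := by
    intro x
    fin_cases x
    · change Complex.I ^ 1 = Complex.I * Complex.I ^ 0; ring
    · change Complex.I ^ 2 = Complex.I * Complex.I ^ 1; ring
    · change Complex.I ^ 3 = Complex.I * Complex.I ^ 2; ring
    · change Complex.I ^ 0 = Complex.I * Complex.I ^ 3
      rw [← pow_succ', Complex.I_pow_four, pow_zero]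
  have hshift : ∀ f k₀ k, phases (φ (f + Pi.single k₀ 1)) k =
      quarterTurn k₀ k * phases (φ f) k := by
    intro f k₀ k
    rw [hφ, hφ, quarterTurn, Pi.add_apply]
    by_cases hk : k = k₀
    · rw [hk, Pi.single_eq_same, if_pos rfl, hsucc]
    · rw [Pi.single_eq_of_ne hk, if_neg hk, add_zero, one_mul]
  have hq : ∀ k₀ k : Fin D, star (quarterTurn k₀ k) * quarterTurn k₀ k = 1 := by
    intro k₀ k
    rw [quarterTurn]
    split_ifs <;> simp
  have hmom : HasPhaseMoments fun f => phases (φ f) := by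
    refine hasPhaseMoments_of_quarterTurn (fun j k => star_phases_mul _ k) ?_
    intro k₀ k l a c
    set S := ∑ f, star (phases (φ f) k) * phases (φ f) l *
      (phases (φ f) a * star (phases (φ f) c)) with hS
    have h1 : S = star (quarterTurn k₀ k) * quarterTurn k₀ l *
        (quarterTurn k₀ a * star (quarterTurn k₀ c)) * S := by
      -- Raising the exponent at `k₀` by one permutes the family, so the moment is unchanged by a
      -- quarter turn at `k₀`.
      conv_lhs => rw [hS, ← Equiv.sum_comp (Equiv.addRight (Pi.single k₀ 1 : Fin D → ZMod 4))]
      rw [hS, Finset.mul_sum]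
      refine Finset.sum_congr rfl fun f _ => ?_
      simp only [Equiv.coe_addRight, hshift, star_mul']
      ring
    conv_lhs => rw [h1]
    calc _ = (star (quarterTurn k₀ k) * quarterTurn k₀ k) *
          (star (quarterTurn k₀ l) * quarterTurn k₀ l) *
          (quarterTurn k₀ a * star (quarterTurn k₀ c) * S) := by ring
      _ = _ := by rw [hq, hq, one_mul, one_mul]
  let e := (Fintype.equivFin (Fin D → ZMod 4)).symm
  refine ⟨_, fun j => φ (e j), Fintype.card_pos, fun k l a c => ?_⟩
  have h1 := hmom k l a c
  rw [← e.sum_comp] at h1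
  rw [h1, Fintype.card_fin]

/-- The expectation `⟨z|Y|z⟩`. -/
noncomputable def expect (z : Fin D → ℂ) (Y : Matrix (Fin D) (Fin D) ℂ) : ℂ := star z ⬝ᵥ Y *ᵥ z

lemma trace_vecMulVec_star_mul (z : Fin D → ℂ) (Y : Matrix (Fin D) (Fin D) ℂ) :
    (vecMulVec z (star z) * Y).trace = expect z Y := by
  rw [vecMulVec_mul, trace_vecMulVec, expect, dotProduct_mulVec, dotProduct_comm]

lemma expect_eq_sum (z : Fin D → ℂ) (Y : Matrix (Fin D) (Fin D) ℂ) :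
    expect z Y = ∑ k, ∑ l, Y k l * (star (z k) * z l) := by
  simp only [expect, dotProduct, mulVec, Finset.mul_sum, Pi.star_apply]
  exact Finset.sum_congr rfl fun k _ => Finset.sum_congr rfl fun l _ => by ring

lemma expect_im {Y : Matrix (Fin D) (Fin D) ℂ} (hY : Y.IsHermitian) (z : Fin D → ℂ) :
    (expect z Y).im = 0 := by
  have h := hY.im_star_dotProduct_mulVec_self z
  rwa [RCLike.im_eq_complex_im] at h

lemma expect_diagonal {z : Fin D → ℂ} (hz : ∀ k, star (z k) * z k = 1) (v : Fin D → ℂ) :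
    expect z (diagonal v) = ∑ k, v k := by
  simp only [expect, dotProduct, mulVec_diagonal, Pi.star_apply]
  refine Finset.sum_congr rfl fun k _ => ?_
  rw [mul_left_comm, hz, mul_one]

/-- The squared Frobenius norm of the off-diagonal part. -/
noncomputable def offSq (Y : Matrix (Fin D) (Fin D) ℂ) : ℝ := ∑ a, ∑ c, if a = c then 0 else ‖Y a c‖ ^ 2

lemma frobNorm_sq_eq_offSq_add (Y : Matrix (Fin D) (Fin D) ℂ) :
    frobNorm Y ^ 2 = offSq Y + ∑ a, ‖Y a a‖ ^ 2 := by
  rw [frobNorm_sq, offSq, ← Finset.sum_add_distrib]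
  refine Finset.sum_congr rfl fun a _ => ?_
  have : ‖Y a a‖ ^ 2 = ∑ c, if a = c then ‖Y a c‖ ^ 2 else 0 := by simp
  rw [this, ← Finset.sum_add_distrib]
  refine Finset.sum_congr rfl fun c _ => ?_
  split_ifs <;> simp

variable {z : J → Fin D → ℂ}

/-- Of the entries of `Y`, only `Y a c` survives off the diagonal, while on the diagonal all the
diagonal entries do. Thus the frame map keeps coherences and sees diagonals only through the trace.
-/
lemma HasPhaseMoments.sum_expect_mul (h : HasPhaseMoments z) (Y : Matrix (Fin D) (Fin D) ℂ)
    (a c : Fin D) : ∑ j, expect (z j) Y * (z j a * star (z j c)) =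
      Fintype.card J * if a = c then Y.trace else Y a c := by
  have h1 : ∑ j, expect (z j) Y * (z j a * star (z j c)) = ∑ k, ∑ l, Y k l *
      ∑ j, star (z j k) * z j l * (z j a * star (z j c)) := by
    simp only [expect_eq_sum, Finset.sum_mul, Finset.mul_sum]
    rw [Finset.sum_comm]
    refine Finset.sum_congr rfl fun k _ => ?_
    rw [Finset.sum_comm]
    refine Finset.sum_congr rfl fun l _ => Finset.sum_congr rfl fun j _ => ?_
    ring
  rw [h1]
  simp only [h _ _ a c]
  by_cases hac : a = c
  · subst hac
    rw [if_pos rfl, trace, Finset.mul_sum]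
    refine Finset.sum_congr rfl fun k _ => ?_
    rw [Finset.sum_eq_single k]
    · simp [mul_comm]
    · intro l _ hl
      rw [if_neg (by grind), mul_zero]
    · simp
  · rw [if_neg hac, Finset.sum_eq_single a]
    · rw [Finset.sum_eq_single c]
      · simp [mul_comm]
      · intro l _ hl
        rw [if_neg (by grind), mul_zero]
      · simp
    · intro k _ hk
      refine Finset.sum_eq_zero fun l _ => ?_
      rw [if_neg (by grind), mul_zero]
    · simp

/-- Pair `sum_expect_mul` with the conjugate entries of `Y`. For traceless `Y` the phase vectors
thus measure exactly the off-diagonal norm. -/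
lemma HasPhaseMoments.sum_norm_sq_expect (h : HasPhaseMoments z)
    (Y : Matrix (Fin D) (Fin D) ℂ) : ∑ j, ‖expect (z j) Y‖ ^ 2 =
      Fintype.card J * (offSq Y + ‖Y.trace‖ ^ 2) := by
  have h1 : ∀ x : ℂ, ((‖x‖ ^ 2 : ℝ) : ℂ) = x * star x := by
    intro x
    rw [Complex.star_def, Complex.mul_conj, Complex.sq_norm]
  have h2 : ∀ j, star (expect (z j) Y) = ∑ a, ∑ c, star (Y a c) * (z j a * star (z j c)) := by
    intro j
    simp only [expect_eq_sum, star_sum, star_mul', star_star]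
  rw [← Complex.ofReal_inj]
  push_cast
  have h3 : ∀ x : ℂ, ((‖x‖ : ℝ) : ℂ) ^ 2 = x * star x := by
    intro x
    rw [← h1, Complex.ofReal_pow]
  simp only [h3, h2, Finset.mul_sum]
  rw [Finset.sum_comm]
  have h4 : ∀ a, ∑ j, ∑ c, expect (z j) Y * (star (Y a c) * (z j a * star (z j c))) =
      Fintype.card J * ((∑ c, if a = c then 0 else Y a c * star (Y a c)) +
        Y.trace * star (Y a a)) := by
    intro a
    have h5 : Y.trace * star (Y a a) = ∑ c, if a = c then Y.trace * star (Y a c) else 0 := by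
      simp
    rw [Finset.sum_comm, h5, ← Finset.sum_add_distrib, Finset.mul_sum]
    refine Finset.sum_congr rfl fun c _ => ?_
    have h6 := h.sum_expect_mul Y a c
    calc ∑ j, expect (z j) Y * (star (Y a c) * (z j a * star (z j c)))
        = star (Y a c) * ∑ j, expect (z j) Y * (z j a * star (z j c)) := by
          rw [Finset.mul_sum]
          exact Finset.sum_congr rfl fun j _ => by ring
      _ = _ := by
          rw [h6]
          split_ifs <;> ring
  simp only [h4]
  simp only [← Finset.mul_sum, Finset.sum_add_distrib]
  congr 2
  · rw [offSq]
    push_cast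
    refine Finset.sum_congr rfl fun a _ => Finset.sum_congr rfl fun c _ => ?_
    split_ifs
    · simp
    · rw [← h1, Complex.ofReal_pow]
  · rw [trace, star_sum]
    rfl

lemma HasPhaseMoments.sum_vecMulVec (h : HasPhaseMoments z)
    (hz : ∀ j k, star (z j k) * z j k = 1) :
    ∑ j, vecMulVec (z j) (star (z j)) = (Fintype.card J : ℂ) • 1 := by
  ext a c
  -- With a repeated index, unimodularity collapses the fourth moment to a second moment.
  have h1 := h a a a c
  simp only [hz, one_mul] at h1
  rw [Matrix.sum_apply, Matrix.smul_apply, one_apply]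
  simp only [vecMulVec_apply, Pi.star_apply]
  rw [h1]
  by_cases hac : a = c <;> simp [hac]

/-- An operator with vanishing expectations in all phase vectors is zero off the diagonal. -/
lemma HasPhaseMoments.off_diagonal_eq_zero (h : HasPhaseMoments z) [Nonempty J]
    {Y : Matrix (Fin D) (Fin D) ℂ} (hY : ∀ j, expect (z j) Y = 0) {a c : Fin D} (hac : a ≠ c) :
    Y a c = 0 := by
  have h1 := h.sum_expect_mul Y a c
  simp only [hY, zero_mul, Finset.sum_const_zero, if_neg hac] at h1
  exact (mul_eq_zero.1 h1.symm).resolve_left (Nat.cast_ne_zero.2 Fintype.card_ne_zero)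

end PhaseMoments

/-! ### Invariance of phase states is triviality of the moments. -/

section PhaseInvariance

variable {D m : ℕ} (b : OrthonormalBasis (Fin D) ℂ (EuclideanSpace ℂ (Fin D)))

lemma rot_phaseSuper_apply (θ : Fin m → Fin D → ℝ) (X : Matrix (Fin D) (Fin D) ℂ) (a c : Fin D) :
    rot b (phaseSuper b θ X) a c = ((1 / D : ℝ) : ℂ) ^ 2 *
      ∑ j, expect (phases (θ j)) (rot b X) * (phases (θ j) a * star (phases (θ j) c)) := by
  rw [phaseSuper, rot_sum, Matrix.sum_apply, Finset.mul_sum]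
  refine Finset.sum_congr rfl fun j _ => ?_
  rw [rot_smul, ← trace_rot b, rot_mul, rot_proj_phaseState, Matrix.smul_mul, trace_smul,
    trace_vecMulVec_star_mul, Matrix.smul_apply, Matrix.smul_apply, vecMulVec_apply]
  simp only [smul_eq_mul, Pi.star_apply]
  ring

lemma rot_phaseUnitary_conj (φ : Fin D → ℝ) (X : Matrix (Fin D) (Fin D) ℂ) (a c : Fin D) :
    rot b (phaseUnitary b φ * X * (phaseUnitary b φ)ᴴ) a c =
      phases φ a * star (phases φ c) * rot b X a c := by
  rw [rot_mul, rot_mul, rot_conjTranspose, rot_phaseUnitary, diagonal_conjTranspose,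
    mul_diagonal, diagonal_mul, Pi.star_apply]
  ring

lemma isPhaseInvariant_of_hasPhaseMoments {θ : Fin m → Fin D → ℝ}
    (h : HasPhaseMoments fun j => phases (θ j)) : IsPhaseInvariant b θ := by
  intro φ X
  refine rot_injective b ?_
  ext a c
  rw [rot_phaseUnitary_conj, rot_phaseSuper_apply, rot_phaseSuper_apply, h.sum_expect_mul,
    h.sum_expect_mul, rot_phaseUnitary_conj]
  by_cases hac : a = c
  · subst hac
    have h1 : (rot b (phaseUnitary b φ * X * (phaseUnitary b φ)ᴴ)).trace = (rot b X).trace := by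
      refine Finset.sum_congr rfl fun k _ => ?_
      rw [diag_apply, rot_phaseUnitary_conj, mul_comm (phases φ k), star_phases_mul, one_mul,
        diag_apply]
    rw [if_pos rfl, if_pos rfl, h1, mul_comm (phases φ a), star_phases_mul, one_mul]
  · rw [if_neg hac, if_neg hac]
    ring

lemma hasPhaseMoments_of_isPhaseInvariant (hD : D ≠ 0) {θ : Fin m → Fin D → ℝ}
    (h : IsPhaseInvariant b θ) : HasPhaseMoments fun j => phases (θ j) := by
  refine hasPhaseMoments_of_quarterTurn (fun j k => star_phases_mul _ k) ?_
  intro k₀ k l a c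
  let φ : Fin D → ℝ := fun κ => if κ = k₀ then Real.pi / 2 else 0
  have hφ : phases φ = quarterTurn k₀ := by
    ext κ
    rw [phases, quarterTurn]
    by_cases hκ : κ = k₀
    · simp only [φ, if_pos hκ]
      rw [mul_comm, Complex.exp_mul_I]
      simp
    · simp [φ, hκ]
  -- Invariance tested on the matrix unit `|k⟩⟨l|` and read off at the entry `(a, c)` is the
  -- quarter-turn relation for one fourth moment.
  have h1 := congrArg (fun A => rot b A a c) (h φ (unrot b (single k l 1)))
  simp only [rot_phaseUnitary_conj, rot_phaseSuper_apply, hφ] at h1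
  have hexp : ∀ (z : Fin D → ℂ) (r : ℂ), expect z (r • single k l 1) = r * (star (z k) * z l) := by
    intro z r
    rw [expect_eq_sum, Finset.sum_eq_single k, Finset.sum_eq_single l]
    · simp
    · intro l' _ hl
      simp [hl.symm]
    · simp
    · intro k' _ hk
      refine Finset.sum_eq_zero fun l' _ => ?_
      simp [hk.symm]
    · simp
  have h2 : rot b (phaseUnitary b φ * unrot b (single k l 1) * (phaseUnitary b φ)ᴴ) =
      (quarterTurn k₀ k * star (quarterTurn k₀ l)) • single k l 1 := by
    ext a c
    rw [rot_phaseUnitary_conj, rot_unrot, hφ, Matrix.smul_apply, single_apply]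
    split_ifs with hc
    · rw [hc.1, hc.2, smul_eq_mul]
    · simp
  have h3 : rot b (unrot b (single k l 1)) = (1 : ℂ) • single k l 1 := by
    rw [rot_unrot, one_smul]
  rw [h2, h3] at h1
  simp only [hexp, one_mul] at h1
  have hD2 : ((1 / D : ℝ) : ℂ) ^ 2 ≠ 0 := by
    simp [hD]
  rw [mul_left_comm] at h1
  have h4 := mul_left_cancel₀ hD2 h1
  rw [← h4, Finset.mul_sum]
  exact Finset.sum_congr rfl fun j _ => by ring

end PhaseInvariance

/-! ### The phase POVM attains the bound for mixed states. -/

section PhasePOVM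

variable {D m : ℕ} (b : OrthonormalBasis (Fin D) ℂ (EuclideanSpace ℂ (Fin D)))

lemma born_phasePOVM_inl (ξ c : ℝ) (θ : Fin m → Fin D → ℝ) (X : Matrix (Fin D) (Fin D) ℂ)
    (i : Fin D) : born (phasePOVM b ξ c θ) X (Sum.inl i) = (1 - ξ) * (rot b X i i).re := by
  rw [← born_rot b, born, phasePOVM, Sum.elim_inl, rot_smul, rot_proj_basis, Matrix.smul_mul,
    trace_smul, trace_mul_comm, trace_mul_single, smul_eq_mul, Complex.re_ofReal_mul]
  simp

lemma trace_phasePOVM_inr (ξ c : ℝ) (θ : Fin m → Fin D → ℝ) (X : Matrix (Fin D) (Fin D) ℂ)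
    (j : Fin m) : (phasePOVM b ξ c θ (Sum.inr j) * X).trace =
      ((c / D : ℝ) : ℂ) * expect (phases (θ j)) (rot b X) := by
  rw [← trace_rot b, rot_mul, phasePOVM, Sum.elim_inr, rot_smul, rot_proj_phaseState,
    Matrix.smul_mul, Matrix.smul_mul, trace_smul, trace_smul, trace_vecMulVec_star_mul]
  simp only [smul_eq_mul]
  push_cast
  ring

lemma born_phasePOVM_inr (ξ c : ℝ) (θ : Fin m → Fin D → ℝ) (X : Matrix (Fin D) (Fin D) ℂ)
    (j : Fin m) : born (phasePOVM b ξ c θ) X (Sum.inr j) =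
      c / D * (expect (phases (θ j)) (rot b X)).re := by
  rw [born, trace_phasePOVM_inr, Complex.re_ofReal_mul]

variable {b} {θ : Fin m → Fin D → ℝ} {ξ c : ℝ}

/-- The trace of the frame equation; it fixes `c` in terms of `m`. -/
lemma mul_card_eq_of_sum_proj (hD : D ≠ 0)
    (h : ∑ j, (c : ℂ) • proj (phaseState b (θ j)) = (ξ : ℂ) • (1 : Matrix (Fin D) (Fin D) ℂ)) :
    c * m = ξ * D := by
  have hD' : (D : ℂ) ≠ 0 := Nat.cast_ne_zero.2 hD
  have h1 := congrArg (fun A => (rot b A).trace) h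
  simp only [rot_sum, rot_smul, rot_one, rot_proj_phaseState, trace_sum, trace_smul,
    trace_vecMulVec, dotProduct, Pi.star_apply, mul_comm _ (star _), star_phases_mul] at h1
  simp [hD'] at h1
  have h2 : ((c * m : ℝ) : ℂ) = ((ξ * D : ℝ) : ℂ) := by
    push_cast
    rw [← h1]
    ring
  exact Complex.ofReal_inj.1 h2

/-- With trivial moments the phase states form a tight frame. -/
lemma sum_proj_of_hasPhaseMoments (hD : D ≠ 0) (hm : m ≠ 0)
    (h : HasPhaseMoments fun j => phases (θ j)) (ξ : ℝ) :
    ∑ j, ((ξ * D / m : ℝ) : ℂ) • proj (phaseState b (θ j)) =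
      (ξ : ℂ) • (1 : Matrix (Fin D) (Fin D) ℂ) := by
  have hD' : (D : ℂ) ≠ 0 := Nat.cast_ne_zero.2 hD
  have hm' : (m : ℂ) ≠ 0 := Nat.cast_ne_zero.2 hm
  refine rot_injective b ?_
  simp only [rot_sum, rot_smul, rot_one, rot_proj_phaseState]
  rw [← Finset.smul_sum, ← Finset.smul_sum, h.sum_vecMulVec fun j k => star_phases_mul _ k,
    smul_smul, smul_smul, Fintype.card_fin]
  congr 1
  push_cast
  field_simp

lemma isPOVM_phasePOVM (hξ : ξ ≤ 1) (hc : 0 ≤ c)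
    (h : ∑ j, (c : ℂ) • proj (phaseState b (θ j)) = (ξ : ℂ) • (1 : Matrix (Fin D) (Fin D) ℂ)) :
    IsPOVM (phasePOVM b ξ c θ) := by
  have hpos : ∀ ψ : EuclideanSpace ℂ (Fin D), (proj ψ).PosSemidef :=
    fun ψ => posSemidef_vecMulVec_self_star _
  have hcast : ∀ r : ℝ, 0 ≤ r → (0 : ℂ) ≤ (r : ℂ) := fun r hr => by exact_mod_cast hr
  refine ⟨?_, ?_⟩
  · rintro (i | j)
    · exact (hpos _).smul (hcast _ (by linarith))
    · exact (hpos _).smul (hcast _ hc)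
  · have hb : ∑ i, proj (b i) = 1 := by
      refine rot_injective b ?_
      simp only [rot_sum, rot_proj_basis, rot_one]
      exact sum_single_one
    rw [Fintype.sum_sum_type]
    simp only [phasePOVM, Sum.elim_inl, Sum.elim_inr]
    rw [h, ← Finset.smul_sum, hb, ← add_smul]
    simp

lemma isInfoComplete_phasePOVM (hD : D ≠ 0) (hξ : ξ ≠ 1) (hc : c ≠ 0) (hm : m ≠ 0)
    (h : HasPhaseMoments fun j => phases (θ j)) : IsInfoComplete (phasePOVM b ξ c θ) := by
  intro X hX
  have : Nonempty (Fin m) := ⟨⟨0, Nat.pos_of_ne_zero hm⟩⟩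
  refine rot_injective b ?_
  rw [rot_zero]
  ext a e
  by_cases hae : a = e
  · subst hae
    have h1 := hX (Sum.inl a)
    rw [← trace_rot b, rot_mul, phasePOVM, Sum.elim_inl, rot_smul, rot_proj_basis,
      Matrix.smul_mul, trace_smul, trace_mul_comm, trace_mul_single] at h1
    have h2 : ((1 - ξ : ℝ) : ℂ) ≠ 0 := Complex.ofReal_ne_zero.2 (sub_ne_zero.2 hξ.symm)
    rw [smul_eq_mul] at h1
    simpa using (mul_eq_zero.1 h1).resolve_left h2
  · refine h.off_diagonal_eq_zero (fun j => ?_) hae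
    have h1 := hX (Sum.inr j)
    rw [trace_phasePOVM_inr] at h1
    refine (mul_eq_zero.1 h1).resolve_left (Complex.ofReal_ne_zero.2 ?_)
    exact div_ne_zero hc (Nat.cast_ne_zero.2 hD)

/-- The phase POVM has rate at least `1 / (1 + μ)` in every direction. -/
lemma le_chiForm_phasePOVM {lam : Fin D → ℝ} {σ : Matrix (Fin D) (Fin D) ℂ} (hD : D ≠ 0)
    (hσ : rot b σ = diagonal fun k => (lam k : ℂ))
    (hnn : ∀ k, 0 ≤ lam k) (hlam : ∑ k, lam k = 1) {μ : ℝ} (hμ : 0 < μ)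
    (hR : ∀ x : Fin D → ℝ, x ⬝ᵥ (covMatrix lam *ᵥ x) ≤ μ * (x ⬝ᵥ x))
    (h : HasPhaseMoments fun j => phases (θ j)) (hξ : ξ = 1 / (1 + μ)) (hcm : c * m = ξ * D)
    (hc : 0 < c) {X : Matrix (Fin D) (Fin D) ℂ} (hX : X.IsHermitian) (htr : X.trace = 0) :
    ENNReal.ofReal (ξ * frobNorm X ^ 2) ≤ chiForm σ (phasePOVM b ξ c θ) X := by
  have hD' : (0 : ℝ) < D := Nat.cast_pos.2 (Nat.pos_of_ne_zero hD)
  have hξ0 : 0 < ξ := by rw [hξ]; positivity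
  have hξ1 : 1 - ξ = μ * ξ := by rw [hξ]; field_simp; ring
  have hp1 : ∀ i, born (phasePOVM b ξ c θ) σ (Sum.inl i) = μ * ξ * lam i := by
    intro i
    rw [born_phasePOVM_inl, hσ, hξ1]
    simp
  have hp2 : ∀ j, born (phasePOVM b ξ c θ) σ (Sum.inr j) = c / D := by
    intro j
    rw [born_phasePOVM_inr, hσ, expect_diagonal (star_phases_mul _), ← Complex.ofReal_sum, hlam]
    simp
  have hH := (isHermitian_rot_iff b).2 hX
  have htr' := (trace_rot b X).trans htr
  rw [← frobNorm_rot b]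
  have hb1 := fun i => born_phasePOVM_inl b ξ c θ X i
  have hb2 := fun j => born_phasePOVM_inr b ξ c θ X j
  rw [hξ1] at hb1
  generalize rot b X = Y at *
  -- A diagonal entry outside the support is caught by a basis outcome that is impossible under `σ`,
  -- which makes the form infinite. Otherwise all terms are finite and the dual bound applies.
  by_cases hex : ∃ i, lam i = 0 ∧ (Y i i).re ≠ 0
  · obtain ⟨i, hi, hY⟩ := hex
    rw [chiForm_eq_top (i := Sum.inl i)]
    · exact le_top
    · rw [hp1, hi, mul_zero]
    · rw [hb1]
      positivity
  push Not at hex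
  rw [chiForm_eq_ofReal]
  rotate_left
  · rintro (i | j)
    · rw [hp1]
      exact mul_nonneg (by positivity) (hnn i)
    · rw [hp2]
      positivity
  · rintro (i | j)
    · rw [hp1, hb1]
      intro h0
      rw [hex i ((mul_eq_zero.1 h0).resolve_left (by positivity)), mul_zero]
    · rw [hp2]
      intro h0
      exact absurd h0 (by positivity)
  refine ENNReal.ofReal_le_ofReal ?_
  rw [Fintype.sum_sum_type]
  simp only [hp1, hp2, hb1, hb2]
  have hdiag : ∀ i, ‖Y i i‖ ^ 2 = (Y i i).re ^ 2 := by
    intro i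
    have : (Y i i).im = 0 := Complex.conj_eq_iff_im.1 (hH.apply i i)
    rw [Complex.sq_norm, Complex.normSq_apply, this]
    ring
  have e1 : ∑ i, (μ * ξ * (Y i i).re) ^ 2 / (μ * ξ * lam i) =
      ξ * (μ * ∑ i, (Y i i).re ^ 2 / lam i) := by
    rw [Finset.mul_sum, Finset.mul_sum]
    refine Finset.sum_congr rfl fun i _ => ?_
    by_cases hi : lam i = 0
    · simp [hi]
    · field_simp
  have e2 : ∑ j, (c / D * (expect (phases (θ j)) Y).re) ^ 2 / (c / D) = ξ * offSq Y := by
    have e3 : ∀ j, (c / D * (expect (phases (θ j)) Y).re) ^ 2 / (c / D) =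
        c / D * ‖expect (phases (θ j)) Y‖ ^ 2 := by
      intro j
      rw [Complex.sq_norm, Complex.normSq_apply, expect_im hH]
      field_simp
      ring
    rw [Finset.sum_congr rfl fun j _ => e3 j, ← Finset.mul_sum, h.sum_norm_sq_expect, htr',
      Fintype.card_fin, norm_zero]
    have : c / D * (m * (offSq Y + 0 ^ 2)) = (c * m) * offSq Y / D := by ring
    rw [this, hcm]
    field_simp
  rw [e1, e2, frobNorm_sq_eq_offSq_add]
  simp only [hdiag]
  have hx : ∑ i, (Y i i).re = 0 := by
    have := congrArg Complex.re htr'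
    simpa [trace] using this
  have := sum_sq_le_mul_sum_div hnn hlam hμ hR hx hex
  nlinarith

end PhasePOVM

/-! ### An optimal POVM at a pure state. -/

section PureState

variable {D : ℕ} {O J : Type*} [Fintype J]

/-- Phase vectors with outcome-dependent intensities `t` and weights `w`. -/
noncomputable def intensityPOVM (w : O → ℝ) (t : O → Fin D → ℝ) (z : J → Fin D → ℂ) :
    O × J → Matrix (Fin D) (Fin D) ℂ := fun q =>
  ((w q.1 / Fintype.card J : ℝ) : ℂ) •
    vecMulVec (fun k => (Real.sqrt (t q.1 k) : ℂ) * z q.2 k)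
      (star fun k => (Real.sqrt (t q.1 k) : ℂ) * z q.2 k)

variable {w : O → ℝ} {t : O → Fin D → ℝ} {z : J → Fin D → ℂ}

/-- The intensities are moved from the vectors into the operator, so that the moments of the bare
phases still apply. -/
lemma born_intensityPOVM (w : O → ℝ) (t : O → Fin D → ℝ) (z : J → Fin D → ℂ)
    (X : Matrix (Fin D) (Fin D) ℂ) (q : O × J) : born (intensityPOVM w t z) X q =
      w q.1 / Fintype.card J * (expect (z q.2)
        (of fun a c => (Real.sqrt (t q.1 a) * Real.sqrt (t q.1 c) : ℂ) * X a c)).re := by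
  rw [born, intensityPOVM, Matrix.smul_mul, trace_smul, trace_vecMulVec_star_mul, smul_eq_mul,
    Complex.re_ofReal_mul]
  congr 2
  rw [expect_eq_sum, expect_eq_sum]
  refine Finset.sum_congr rfl fun k _ => Finset.sum_congr rfl fun l _ => ?_
  rw [star_mul', of_apply, Complex.star_def, Complex.conj_ofReal]
  ring

variable [Fintype O]

lemma isPOVM_intensityPOVM [Nonempty J] (hw : ∀ o, 0 ≤ w o) (ht : ∀ o k, 0 ≤ t o k)
    (hsum : ∀ k, ∑ o, w o * t o k = 1)
    (hz : ∀ j k, star (z j k) * z j k = 1) (h : HasPhaseMoments z) :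
    IsPOVM (intensityPOVM w t z) := by
  have hJ : (Fintype.card J : ℂ) ≠ 0 := Nat.cast_ne_zero.2 Fintype.card_ne_zero
  refine ⟨fun q => (posSemidef_vecMulVec_self_star _).smul ?_, ?_⟩
  · have : 0 ≤ w q.1 / Fintype.card J := div_nonneg (hw _) (Nat.cast_nonneg _)
    exact_mod_cast this
  · rw [Fintype.sum_prod_type]
    ext a c
    have h1 := congrArg (fun A : Matrix (Fin D) (Fin D) ℂ => A a c) (h.sum_vecMulVec hz)
    simp only [Matrix.sum_apply, vecMulVec_apply, Pi.star_apply, Matrix.smul_apply,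
      smul_eq_mul] at h1
    have h2 : ∀ o, ∑ j, intensityPOVM w t z (o, j) a c =
        ((w o * (Real.sqrt (t o a) * Real.sqrt (t o c)) : ℝ) : ℂ) *
          (1 : Matrix (Fin D) (Fin D) ℂ) a c := by
      intro o
      calc ∑ j, intensityPOVM w t z (o, j) a c =
          ((w o / Fintype.card J : ℝ) : ℂ) * (Real.sqrt (t o a) * Real.sqrt (t o c)) *
            ∑ j, z j a * star (z j c) := by
            rw [Finset.mul_sum]
            refine Finset.sum_congr rfl fun j _ => ?_
            rw [intensityPOVM, Matrix.smul_apply, vecMulVec_apply, Pi.star_apply, star_mul',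
              Complex.star_def, Complex.conj_ofReal, smul_eq_mul]
            ring
        _ = _ := by
            rw [h1]
            push_cast
            field_simp
    rw [Matrix.sum_apply]
    simp only [Matrix.sum_apply, h2, ← Finset.sum_mul, ← Complex.ofReal_sum]
    by_cases hac : a = c
    · subst hac
      simp only [Real.mul_self_sqrt (ht _ a), hsum]
      simp
    · simp [one_apply_ne hac]

/-- Intensities with enough dispersion give a POVM of rate at least one at a pure state. -/
lemma le_chiForm_intensityPOVM [Nonempty J] {k₀ : Fin D} (hw : ∀ o, 0 < w o)
    (ht : ∀ o k, 0 ≤ t o k) (ht0 : ∀ o, t o k₀ = 1)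
    (hoff : ∀ a c, a ≠ c → 1 ≤ ∑ o, w o * (t o a * t o c))
    (hdiag : ∀ x : Fin D → ℝ, ∑ k, x k = 0 → ∑ k, x k ^ 2 ≤ ∑ o, w o * (∑ k, t o k * x k) ^ 2)
    (hz : ∀ j k, star (z j k) * z j k = 1) (h : HasPhaseMoments z)
    {X : Matrix (Fin D) (Fin D) ℂ} (hX : X.IsHermitian) (htr : X.trace = 0) :
    ENNReal.ofReal (1 * frobNorm X ^ 2) ≤
      chiForm (diagonal fun k => ((Pi.single k₀ 1 : Fin D → ℝ) k : ℂ))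
        (intensityPOVM w t z) X := by
  have hJ : (0 : ℝ) < Fintype.card J := Nat.cast_pos.2 Fintype.card_pos
  have hp : ∀ q, born (intensityPOVM w t z)
      (diagonal fun k => ((Pi.single k₀ 1 : Fin D → ℝ) k : ℂ)) q = w q.1 / Fintype.card J := by
    intro q
    rw [born_intensityPOVM]
    -- Rescaling leaves the pure state unchanged because its intensity is one for every `o`; hence
    -- no outcome is impossible under it.
    have : (of fun a c => (Real.sqrt (t q.1 a) * Real.sqrt (t q.1 c) : ℂ) *
        (diagonal fun k => ((Pi.single k₀ 1 : Fin D → ℝ) k : ℂ)) a c) =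
        diagonal fun k => ((Pi.single k₀ 1 : Fin D → ℝ) k : ℂ) := by
      ext a c
      rw [of_apply, diagonal_apply]
      split_ifs with hac
      · subst hac
        by_cases ha : a = k₀
        · subst ha
          simp [ht0]
        · simp [ha]
      · simp
    rw [this, expect_diagonal (hz _), ← Complex.ofReal_sum]
    simp
  have hpos : ∀ o, 0 < w o / Fintype.card J := fun o => div_pos (hw o) hJ
  rw [chiForm_eq_ofReal (fun q => (hp q).symm ▸ (hpos q.1).le)
    (fun q hq => absurd ((hp q).symm.trans hq) (hpos q.1).ne')]
  refine ENNReal.ofReal_le_ofReal ?_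
  simp only [hp, born_intensityPOVM]
  set Y : O → Matrix (Fin D) (Fin D) ℂ := fun o =>
    of fun a c => (Real.sqrt (t o a) * Real.sqrt (t o c) : ℂ) * X a c with hY
  have hYH : ∀ o, (Y o).IsHermitian := by
    intro o
    ext a c
    have := hX.apply a c
    simp only [hY, conjTranspose_apply, of_apply, star_mul', Complex.star_def,
      Complex.conj_ofReal]
    rw [← this, Complex.star_def]
    ring
  have hoffY : ∀ o, offSq (Y o) = ∑ a, ∑ c, t o a * t o c *
      if a = c then 0 else ‖X a c‖ ^ 2 := by
    intro o
    refine Finset.sum_congr rfl fun a _ => Finset.sum_congr rfl fun c _ => ?_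
    split_ifs
    · simp
    · simp only [hY, of_apply, norm_mul, Complex.norm_real, mul_pow, Real.norm_eq_abs, sq_abs,
        Real.sq_sqrt (ht o _)]
  have hreal : ∀ a, X a a = ((X a a).re : ℂ) := fun a =>
    (Complex.conj_eq_iff_re.1 (hX.apply a a)).symm
  have htrY : ∀ o, ‖(Y o).trace‖ ^ 2 = (∑ a, t o a * (X a a).re) ^ 2 := by
    intro o
    have : (Y o).trace = ((∑ a, t o a * (X a a).re : ℝ) : ℂ) := by
      push_cast
      refine Finset.sum_congr rfl fun a _ => ?_
      simp only [hY, diag_apply, of_apply]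
      rw [← hreal, ← Complex.ofReal_mul, Real.mul_self_sqrt (ht o a)]
    rw [this, Complex.norm_real, Real.norm_eq_abs, sq_abs]
  have hq : ∀ o, ∑ j, (w o / Fintype.card J * (expect (z j) (Y o)).re) ^ 2 /
      (w o / Fintype.card J) = w o * offSq (Y o) + w o * (∑ a, t o a * (X a a).re) ^ 2 := by
    intro o
    have e3 : ∀ j, (w o / Fintype.card J * (expect (z j) (Y o)).re) ^ 2 /
        (w o / Fintype.card J) = w o / Fintype.card J * ‖expect (z j) (Y o)‖ ^ 2 := by
      intro j
      rw [Complex.sq_norm, Complex.normSq_apply, expect_im (hYH o)]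
      have := (hw o).ne'
      field_simp
      ring
    rw [Finset.sum_congr rfl fun j _ => e3 j, ← Finset.mul_sum, h.sum_norm_sq_expect, htrY]
    field_simp
  change _ ≤ ∑ q : O × J, (w q.1 / Fintype.card J * (expect (z q.2) (Y q.1)).re) ^ 2 /
    (w q.1 / Fintype.card J)
  rw [Fintype.sum_prod_type]
  simp only [hq, Finset.sum_add_distrib]
  rw [one_mul, frobNorm_sq_eq_offSq_add]
  refine add_le_add ?_ ?_
  · simp only [hoffY, Finset.mul_sum]
    rw [Finset.sum_comm]
    refine Finset.sum_le_sum fun a _ => ?_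
    rw [Finset.sum_comm]
    refine Finset.sum_le_sum fun c _ => ?_
    by_cases hac : a = c
    · simp [hac]
    · rw [if_neg hac]
      have := mul_le_mul_of_nonneg_right (hoff a c hac) (sq_nonneg ‖X a c‖)
      rw [one_mul, Finset.sum_mul] at this
      refine this.trans (le_of_eq (Finset.sum_congr rfl fun o _ => ?_))
      ring
  · have hx : ∑ i, (X i i).re = 0 := by
      have := congrArg Complex.re htr
      simpa [trace] using this
    refine le_trans (le_of_eq ?_) (hdiag _ hx)
    refine Finset.sum_congr rfl fun a _ => ?_
    rw [hreal a, Complex.norm_real, Real.norm_eq_abs, sq_abs, Complex.ofReal_re]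

/-- At a pure state some POVM has rate at least one in every direction. -/
theorem exists_isPOVM_one_le_chiForm (hD : 2 ≤ D) (k₀ : Fin D) :
    ∃ (r : ℕ) (E : Fin r → Matrix (Fin D) (Fin D) ℂ), IsPOVM E ∧
      ∀ X : Matrix (Fin D) (Fin D) ℂ, X.IsHermitian → X.trace = 0 →
        ENNReal.ofReal (1 * frobNorm X ^ 2) ≤
          chiForm (diagonal fun k => ((Pi.single k₀ 1 : Fin D → ℝ) k : ℂ)) E X := by
  obtain ⟨m, θ, hm, hmom⟩ := exists_hasPhaseMoments D
  have : Nonempty (Fin m) := ⟨⟨0, hm⟩⟩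
  have hz : ∀ (j : Fin m) k, star (phases (θ j) k) * phases (θ j) k = 1 :=
    fun j k => star_phases_mul _ k
  -- Off `k₀` the intensities are all `s` with weight `2/s²`, equal to `s` at a single index with
  -- weight `(s-2)/s²` for each of the `s - 2` indices, and all zero with the remaining `(4s-6)/s²`.
  -- So they have mean `1`, mixed second moments `2` and second moments `s`.
  set s : ℝ := D + 1 with hs
  have hs3 : 3 ≤ s := by
    have : (2 : ℝ) ≤ D := by exact_mod_cast hD
    linarith
  have hs2 : 0 < s ^ 2 := by positivity
  let w : Option (Fin D) → ℝ := fun o => o.elim (2 / s ^ 2)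
    fun j => if j = k₀ then (4 * s - 6) / s ^ 2 else (s - 2) / s ^ 2
  let t : Option (Fin D) → Fin D → ℝ := fun o k => if k = k₀ then 1 else
    o.elim s fun j => if j = k then s else 0
  have hw : ∀ o, 0 < w o := by
    rintro (_ | j)
    · exact div_pos two_pos hs2
    · simp only [w, Option.elim_some]
      split_ifs
      · exact div_pos (by linarith) hs2
      · exact div_pos (by linarith) hs2
  have ht : ∀ o k, 0 ≤ t o k := by
    rintro (_ | j) k
    · simp only [t, Option.elim_none]
      split_ifs <;> linarith
    · simp only [t, Option.elim_some]
      split_ifs <;> linarith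
  have hcard : ((Finset.univ.erase k₀).card : ℝ) = s - 2 := by
    rw [Finset.card_erase_of_mem (Finset.mem_univ _), Finset.card_univ, Fintype.card_fin,
      Nat.cast_sub (by omega), hs]
    push_cast
    ring
  have hexp : ∀ g : Option (Fin D) → ℝ, ∑ o, w o * g o = 2 / s ^ 2 * g none +
      ((4 * s - 6) / s ^ 2 * g (some k₀) +
        (s - 2) / s ^ 2 * ∑ j ∈ Finset.univ.erase k₀, g (some j)) := by
    intro g
    rw [Fintype.sum_option, ← Finset.add_sum_erase _ _ (Finset.mem_univ k₀), Finset.mul_sum]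
    congr 2
    · simp [w]
    · refine Finset.sum_congr rfl fun j hj => ?_
      simp [w, (Finset.mem_erase.1 hj).1]
  have hmean : ∀ k, ∑ o, w o * t o k = 1 := by
    intro k
    rw [hexp]
    by_cases hk : k = k₀
    · simp only [t, if_pos hk, Finset.sum_const, nsmul_eq_mul, hcard]
      field_simp
      ring
    · simp only [t, if_neg hk, Option.elim_none, Option.elim_some, if_neg (Ne.symm hk)]
      rw [Finset.sum_ite_eq', if_pos (Finset.mem_erase.2 ⟨hk, Finset.mem_univ k⟩)]
      field_simp
      ring
  have hoff : ∀ a c, a ≠ c → 1 ≤ ∑ o, w o * (t o a * t o c) := by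
    intro a c hac
    by_cases ha : a = k₀
    · have : ∀ o, t o a = 1 := fun o => if_pos ha
      simp only [this, one_mul, hmean, le_refl]
    · by_cases hc : c = k₀
      · have : ∀ o, t o c = 1 := fun o => if_pos hc
        simp only [this, mul_one, hmean, le_refl]
      · rw [hexp]
        have h1 : ∀ j, t (some j) a * t (some j) c = 0 := by
          intro j
          simp only [t, if_neg ha, if_neg hc, Option.elim_some]
          by_cases hj : j = a
          · rw [if_neg (fun h => hac (hj.symm.trans h)), mul_zero]
          · rw [if_neg hj, zero_mul]
        simp only [h1, Finset.sum_const_zero, mul_zero, add_zero]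
        simp only [t, if_neg ha, if_neg hc, Option.elim_none]
        have : 2 / s ^ 2 * (s * s) = 2 := by field_simp
        rw [this]
        norm_num
  have hdiag : ∀ x : Fin D → ℝ, ∑ k, x k = 0 →
      ∑ k, x k ^ 2 ≤ ∑ o, w o * (∑ k, t o k * x k) ^ 2 := by
    intro x hx
    rw [hexp]
    have hx' : ∑ k ∈ Finset.univ.erase k₀, x k = - x k₀ := by
      rw [← Finset.add_sum_erase _ _ (Finset.mem_univ k₀)] at hx
      linarith
    have hT : ∀ o, ∑ k, t o k * x k = x k₀ + ∑ k ∈ Finset.univ.erase k₀,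
        (o.elim s fun j => if j = k then s else 0) * x k := by
      intro o
      rw [← Finset.add_sum_erase _ _ (Finset.mem_univ k₀)]
      congr 1
      · simp [t]
      · refine Finset.sum_congr rfl fun k hk => ?_
        simp [t, (Finset.mem_erase.1 hk).1]
    have h1 : ∑ k, t none k * x k = x k₀ - s * x k₀ := by
      rw [hT]
      simp only [Option.elim_none, ← Finset.mul_sum, hx']
      ring
    have h2 : ∑ k, t (some k₀) k * x k = x k₀ := by
      rw [hT, Finset.sum_eq_zero, add_zero]
      intro k hk
      simp [(Finset.mem_erase.1 hk).1.symm]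
    have h3 : ∀ j ∈ Finset.univ.erase k₀, (∑ k, t (some j) k * x k) ^ 2 =
        x k₀ ^ 2 + 2 * s * x k₀ * x j + s ^ 2 * x j ^ 2 := by
      intro j hj
      have : ∑ k, t (some j) k * x k = x k₀ + s * x j := by
        rw [hT]
        simp only [Option.elim_some, ite_mul, zero_mul]
        rw [Finset.sum_ite_eq, if_pos hj]
      rw [this]
      ring
    rw [h1, h2, Finset.sum_congr rfl h3, Finset.sum_add_distrib, Finset.sum_add_distrib,
      Finset.sum_const, nsmul_eq_mul, hcard, ← Finset.mul_sum, ← Finset.mul_sum, hx',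
      ← Finset.add_sum_erase _ _ (Finset.mem_univ k₀)]
    set N := ∑ k ∈ Finset.univ.erase k₀, x k ^ 2 with hN
    have hN0 : 0 ≤ N := Finset.sum_nonneg fun k _ => sq_nonneg _
    -- The dispersion form is diagonal on traceless vectors, with coefficients `1` at `k₀` and `s -
    -- 2 = D - 1 ≥ 1` elsewhere.
    have : 2 / s ^ 2 * (x k₀ - s * x k₀) ^ 2 + ((4 * s - 6) / s ^ 2 * x k₀ ^ 2 +
        (s - 2) / s ^ 2 * ((s - 2) * x k₀ ^ 2 + 2 * s * x k₀ * -x k₀ + s ^ 2 * N)) =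
        x k₀ ^ 2 + (s - 2) * N := by
      field_simp
      ring
    rw [this]
    nlinarith
  have ht0 : ∀ o, t o k₀ = 1 := fun o => if_pos rfl
  let e := (Fintype.equivFin (Option (Fin D) × Fin m)).symm
  refine ⟨_, intensityPOVM w t (fun j => phases (θ j)) ∘ e, isPOVM_comp_equiv e
    (isPOVM_intensityPOVM (fun o => (hw o).le) ht hmean hz hmom), fun X hX htr => ?_⟩
  rw [chiForm_comp_equiv]
  exact le_chiForm_intensityPOVM hw ht ht0 hoff hdiag hz hmom hX htr

end PureState

/-! ### Rates of mixed states, of pure states and near pure states. -/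

section Main

variable {D : ℕ} {σ : Matrix (Fin D) (Fin D) ℂ} {lam : Fin D → ℝ}
  {b : OrthonormalBasis (Fin D) ℂ (EuclideanSpace ℂ (Fin D))}

lemma eigenvalues_of_isState (hσ : IsState σ) (hd : rot b σ = diagonal fun k => (lam k : ℂ)) :
    (∀ k, 0 ≤ lam k) ∧ ∑ k, lam k = 1 := by
  have h := (isState_rot_iff b).2 hσ
  rw [hd] at h
  refine ⟨fun k => ?_, ?_⟩
  · have := h.1.diag_nonneg (i := k)
    rw [diagonal_apply_eq] at this
    exact_mod_cast this
  · have := h.2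
    rw [trace_diagonal] at this
    exact_mod_cast this

lemma frobNorm_sq_of_eigenbasis (hd : rot b σ = diagonal fun k => (lam k : ℂ)) :
    frobNorm σ ^ 2 = ∑ k, lam k ^ 2 := by
  rw [← frobNorm_rot b, hd, frobNorm_sq]
  refine Finset.sum_congr rfl fun a _ => ?_
  rw [Finset.sum_eq_single a]
  · simp
  · intro c _ hc
    simp [diagonal_apply_ne' _ hc]
  · simp

lemma frobNorm_of_isPure (h : IsPure σ) : frobNorm σ = 1 := by
  obtain ⟨ψ, hψ, rfl⟩ := h
  have h1 : ∑ i, ‖ψ.ofLp i‖ ^ 2 = 1 := by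
    rw [← EuclideanSpace.norm_sq_eq, hψ, one_pow]
  rw [frobNorm_eq_iff zero_le_one]
  simp only [proj, vecMulVec_apply, Pi.star_apply, norm_mul, norm_star, mul_pow]
  rw [← Finset.sum_mul_sum, h1]
  norm_num

lemma eq_single_of_apply_eq_one (hnn : ∀ k, 0 ≤ lam k) (hlam : ∑ k, lam k = 1) {k : Fin D}
    (hk : lam k = 1) : lam = Pi.single k 1 := by
  ext l
  by_cases hl : l = k
  · rw [hl, hk, Pi.single_eq_same]
  · rw [Pi.single_eq_of_ne hl]
    have h3 := Finset.add_sum_erase Finset.univ lam (Finset.mem_univ k)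
    have h4 := Finset.single_le_sum (fun l _ => hnn l)
      (Finset.mem_erase.2 ⟨hl, Finset.mem_univ l⟩)
    linarith [hnn l]

/-- Purity means `∑ λ² = 1 = ∑ λ`, and then each nonnegative term `λ_k (1 - λ_k)` is zero. -/
lemma isPure_iff (hnn : ∀ k, 0 ≤ lam k) (hlam : ∑ k, lam k = 1)
    (hd : rot b σ = diagonal fun k => (lam k : ℂ)) : IsPure σ ↔ ∃ k, lam k = 1 := by
  constructor
  · intro h
    have h1 := frobNorm_sq_of_eigenbasis hd
    rw [frobNorm_of_isPure h, one_pow] at h1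
    have h2 : ∑ k, lam k * (1 - lam k) = 0 := by
      simp only [mul_sub, Finset.sum_sub_distrib, mul_one, ← sq, hlam, ← h1, sub_self]
    have hle : ∀ k, lam k ≤ 1 := fun k =>
      hlam ▸ Finset.single_le_sum (fun l _ => hnn l) (Finset.mem_univ k)
    obtain ⟨k, -, hk0⟩ := Finset.exists_ne_zero_of_sum_ne_zero (hlam.trans_ne one_ne_zero)
    have h3 := (Finset.sum_eq_zero_iff_of_nonneg fun k _ =>
      mul_nonneg (hnn k) (sub_nonneg.2 (hle k))).1 h2 k (Finset.mem_univ k)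
    exact ⟨k, by linarith [(mul_eq_zero.1 h3).resolve_left hk0]⟩
  · rintro ⟨k, hk⟩
    refine ⟨b k, b.orthonormal.1 k, rot_injective b ?_⟩
    rw [hd, rot_proj_basis, eq_single_of_apply_eq_one hnn hlam hk, ← diagonal_single]
    congr 1
    ext l
    by_cases hl : l = k
    · simp [hl]
    · simp [hl]

lemma IsSmallRadius.le {ε : ℝ} (h : IsSmallRadius σ ε)
    (hb : ∀ α, toEuclideanLin σ (b α) = (lam α : ℂ) • b α) {k : Fin D} (hk : lam k ≠ 0) :
    ε ≤ lam k := by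
  refine h.2 _ hk (Module.End.hasEigenvalue_of_hasEigenvector (x := (b k).ofLp)
    ⟨Module.End.mem_eigenspace_iff.2 ?_, ?_⟩)
  · have := congrArg WithLp.ofLp (hb k)
    rwa [toLpLin_apply] at this
  · intro h0
    exact b.orthonormal.ne_zero k ((WithLp.ofLp_eq_zero 2).1 h0)

/-- This gives access to the triangle inequality. -/
lemma frobNorm_eq_norm (X : Matrix (Fin D) (Fin D) ℂ) :
    frobNorm X = ‖(WithLp.toLp 2 fun q : Fin D × Fin D => X q.1 q.2 :
      EuclideanSpace ℂ (Fin D × Fin D))‖ := by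
  rw [frobNorm_eq_iff (norm_nonneg _), EuclideanSpace.norm_sq_eq, Fintype.sum_prod_type]

lemma frobNorm_le_add (X Y : Matrix (Fin D) (Fin D) ℂ) :
    frobNorm X ≤ frobNorm Y + frobNorm (Y - X) := by
  simp only [frobNorm_eq_norm]
  exact norm_le_norm_add_norm_sub _ _

variable {μ : ℝ}

/-- For a mixed state every POVM has a direction of rate at most `1 / (1 + μ)` in which one can
move by any small radius. -/
lemma exists_direction_of_eigenbasis {ι : Type*} [Fintype ι]
    {E : ι → Matrix (Fin D) (Fin D) ℂ} (hE : IsPOVM E)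
    (hb : ∀ α, toEuclideanLin σ (b α) = (lam α : ℂ) • b α)
    (hnn : ∀ k, 0 ≤ lam k) (hlam : ∑ k, lam k = 1) (hμ : 0 < μ)
    (hev : Module.End.HasEigenvalue (toLin' (covMatrix lam)) μ) :
    ∃ X ∈ directions D, chiForm σ E X ≤ ENNReal.ofReal (1 / (1 + μ)) ∧
      ∀ ε, IsSmallRadius σ ε → IsState (σ + (ε : ℂ) • X) := by
  have hd := rot_eigenbasis b hb
  obtain ⟨u, hu0, hu1, hu2⟩ := exists_relative_eigenvector hlam hμ.ne' hev
  obtain ⟨X, hX, hsupp, hle⟩ := exists_direction_chiForm_le ((isPOVM_rot_iff b).2 hE) hnn hlam hμ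
    hu0 hu1 hu2
  refine ⟨unrot b X, ?_, ?_, fun ε hε => ?_⟩
  · rwa [← rot_mem_directions_iff b, rot_unrot]
  · rwa [← chiForm_rot b, rot_unrot, hd]
  · rw [← isState_rot_iff b, rot_add, rot_smul, rot_unrot, hd]
    exact isState_diagonal_add_smul hnn hlam hε.1.le hX fun a c hac =>
      ⟨hε.le hb (hsupp a c hac).1, hε.le hb (hsupp a c hac).2⟩

lemma directions_nonempty (hD : 2 ≤ D) : (directions D).Nonempty :=
  ⟨_, pairDir_mem_directions (j := ⟨0, by omega⟩) (k := ⟨1, by omega⟩) (by simp) norm_one⟩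

/-- The rates of a mixed state, and the optimality of every phase POVM. -/
theorem rates_of_pos (hD : D ≠ 0) (hσ : IsState σ)
    (hb : ∀ α, toEuclideanLin σ (b α) = (lam α : ℂ) • b α) (hμ : 0 < μ)
    (hev : Module.End.HasEigenvalue (toLin' (covMatrix lam)) μ)
    (hR : ∀ x : Fin D → ℝ, x ⬝ᵥ (covMatrix lam *ᵥ x) ≤ μ * (x ⬝ᵥ x))
    {m : ℕ} {θ : Fin m → Fin D → ℝ} {c : ℝ} (hθ : HasPhaseMoments fun j => phases (θ j))
    (hc : ∑ j, (c : ℂ) • proj (phaseState b (θ j)) =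
      ((1 / (1 + μ) : ℝ) : ℂ) • (1 : Matrix (Fin D) (Fin D) ℂ)) :
    IsPOVM (phasePOVM b (1 / (1 + μ)) c θ) ∧ IsInfoComplete (phasePOVM b (1 / (1 + μ)) c θ) ∧
    (dirDivergenceRate σ = ENNReal.ofReal (1 / (1 + μ)) ∧
      povmDirRate σ (phasePOVM b (1 / (1 + μ)) c θ) = ENNReal.ofReal (1 / (1 + μ)) ∧
      ∃ (r : ℕ) (E : Fin r → Matrix (Fin D) (Fin D) ℂ), IsPOVM E ∧
        povmDirRate σ E = dirDivergenceRate σ) ∧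
    ∀ ε, IsSmallRadius σ ε → divergenceRate σ ε = ENNReal.ofReal (1 / (1 + μ)) ∧
      povmRate σ ε (phasePOVM b (1 / (1 + μ)) c θ) = ENNReal.ofReal (1 / (1 + μ)) ∧
      ∃ (r : ℕ) (E : Fin r → Matrix (Fin D) (Fin D) ℂ), IsPOVM E ∧
        povmRate σ ε E = divergenceRate σ ε := by
  have hd := rot_eigenbasis b hb
  obtain ⟨hnn, hlam⟩ := eigenvalues_of_isState hσ hd
  have hξ0 : 0 < 1 / (1 + μ) := by positivity
  have hξ1 : 1 / (1 + μ) < 1 := by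
    rw [div_lt_one (by positivity)]
    linarith
  have hcm := mul_card_eq_of_sum_proj hD hc
  have hcm0 : 0 < c * m := by
    rw [hcm]
    exact mul_pos hξ0 (Nat.cast_pos.2 (Nat.pos_of_ne_zero hD))
  -- Positivity of `c` is not assumed; it follows from `c m = ξ D > 0`.
  have hc0 : 0 < c := pos_of_mul_pos_left hcm0 (Nat.cast_nonneg m)
  have hm : m ≠ 0 := by
    rintro rfl
    simp at hcm0
  have hP := isPOVM_phasePOVM hξ1.le hc0.le hc
  have hlow := fun X hX htr =>
    le_chiForm_phasePOVM hD hd hnn hlam hμ hR hθ rfl hcm hc0 (X := X) hX htr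
  refine ⟨hP, isInfoComplete_phasePOVM hD hξ1.ne hc0.ne' hm hθ,
    dirDivergenceRate_eq hP (le_povmDirRate hlow) fun r F hF => ?_, fun ε hε =>
    divergenceRate_eq hP (le_povmRate hσ hξ0.le hε.1 hlow) fun r F hF => ?_⟩
  · obtain ⟨X, hX, hle, -⟩ := exists_direction_of_eigenbasis hF hb hnn hlam hμ hev
    exact (iInf₂_le X hX).trans hle
  · obtain ⟨X, hX, hle, hst⟩ := exists_direction_of_eigenbasis hF hb hnn hlam hμ hev
    exact (povmRate_le hX.2.2 hε.1 (hst ε hε)).2.trans hle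

/-- The directional rate of a pure state. -/
theorem dirRate_of_single (hD : 2 ≤ D) {k₀ : Fin D}
    (hd : rot b σ = diagonal fun k => ((Pi.single k₀ 1 : Fin D → ℝ) k : ℂ)) :
    dirDivergenceRate σ = 1 ∧
      ∃ (r : ℕ) (E : Fin r → Matrix (Fin D) (Fin D) ℂ), IsPOVM E ∧
        povmDirRate σ E = dirDivergenceRate σ := by
  obtain ⟨r, E, hE, hlow⟩ := exists_isPOVM_one_le_chiForm hD k₀
  have hrot : (fun i => rot b (unrot b (E i))) = E := funext fun i => rot_unrot b (E i)
  have hE' : IsPOVM fun i => unrot b (E i) := by rwa [← isPOVM_rot_iff b, hrot]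
  obtain ⟨l, hl⟩ : ∃ l, k₀ ≠ l := by
    have : Nontrivial (Fin D) := Fin.nontrivial_iff_two_le.2 hD
    obtain ⟨l, hl⟩ := exists_ne k₀
    exact ⟨l, hl.symm⟩
  obtain ⟨h1, -, h2⟩ := dirDivergenceRate_eq (σ := σ) (x := 1) hE' (by
      rw [← ENNReal.ofReal_one]
      refine le_povmDirRate fun X hX htr => ?_
      rw [← chiForm_rot b, hrot, hd, ← frobNorm_rot b]
      exact hlow _ ((isHermitian_rot_iff b).2 hX) ((trace_rot b X).trans htr)) (by
      intro r F hF
      obtain ⟨X, hX, hle⟩ := exists_direction_chiForm_le_one ((isPOVM_rot_iff b).2 hF) hl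
      refine (iInf₂_le (unrot b X) ?_).trans ?_
      · rwa [← rot_mem_directions_iff b, rot_unrot]
      · rwa [← chiForm_rot b, rot_unrot, hd])
  exact ⟨h1, h2⟩

/-- The divergence rate of a state of full rank is close to one when its purity is. -/
lemma divergenceRate_of_posDef (hD : 2 ≤ D) (hσ : IsState σ) (hpos : σ.PosDef) {ε : ℝ}
    (hε : IsSmallRadius σ ε) :
    ENNReal.ofReal (1 - 2 * (1 - frobNorm σ ^ 2)) ≤ divergenceRate σ ε ∧
      divergenceRate σ ε ≤ 1 := by
  have hH := hσ.1.1
  have hb : ∀ α, toEuclideanLin σ (hH.eigenvectorBasis α) =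
      (hH.eigenvalues α : ℂ) • hH.eigenvectorBasis α := by
    intro α
    rw [toLpLin_apply, hH.mulVec_eigenvectorBasis]
    rfl
  have hd := rot_eigenbasis _ hb
  obtain ⟨hnn, hlam⟩ := eigenvalues_of_isState hσ hd
  obtain ⟨μ, hμ, hR⟩ := exists_isGreatest_eigenvalue_covMatrix (by omega) hH.eigenvalues
  obtain ⟨hμ0, hμ1⟩ := largest_eigenvalue_eq_zero_iff hnn hlam hμ.1 hR
  -- In dimension at least two, full rank excludes a point mass, so the theory of mixed states
  -- applies.
  have hμpos : 0 < μ := by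
    refine lt_of_le_of_ne hμ0 fun h => ?_
    obtain ⟨k, hk⟩ := hμ1.1 h.symm
    have : Nontrivial (Fin D) := Fin.nontrivial_iff_two_le.2 hD
    obtain ⟨l, hl⟩ := exists_ne k
    have h1 := congrFun (eq_single_of_apply_eq_one hnn hlam hk) l
    rw [Pi.single_eq_of_ne hl] at h1
    exact (hpos.eigenvalues_pos l).ne' h1
  obtain ⟨m, θ, hm, hmom⟩ := exists_hasPhaseMoments D
  obtain ⟨-, -, -, h⟩ := rates_of_pos (by omega) hσ hb hμpos hμ.1 hR hmom
    (sum_proj_of_hasPhaseMoments (by omega) hm.ne' hmom _)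
  rw [(h ε hε).1]
  refine ⟨ENNReal.ofReal_le_ofReal ?_, ?_⟩
  · have h1 := eigenvalue_covMatrix_le_trace hnn hlam hμ.1
    rw [← frobNorm_sq_of_eigenbasis hd] at h1
    rw [le_div_iff₀ (by positivity)]
    nlinarith
  · rw [← ENNReal.ofReal_one]
    refine ENNReal.ofReal_le_ofReal ?_
    rw [div_le_one (by positivity)]
    linarith

end Main
end QChiSq

/-! ### Assembly. -/

theorem theorem5 {D : ℕ} (hD : 2 ≤ D) (σ : Matrix (Fin D) (Fin D) ℂ) (hσ : QChiSq.IsState σ)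
    (lam : Fin D → ℝ) (b : OrthonormalBasis (Fin D) ℂ (EuclideanSpace ℂ (Fin D)))
    (hb : ∀ α, Matrix.toEuclideanLin σ (b α) = (lam α : ℂ) • b α) :
    ∃ μ ξ : ℝ,
      IsGreatest {t : ℝ | Module.End.HasEigenvalue
        (Matrix.toLin' (QChiSq.covMatrix lam)) t} μ ∧
      ξ = 1 / (1 + μ) ∧
      -- the value of the divergence rate; the maximum and the minima in it are attained
      (¬ QChiSq.IsPure σ → ∀ ε : ℝ, QChiSq.IsSmallRadius σ ε →
        QChiSq.divergenceRate σ ε = ENNReal.ofReal ξ ∧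
        (∃ (r : ℕ) (E : Fin r → Matrix (Fin D) (Fin D) ℂ), QChiSq.IsPOVM E ∧
          QChiSq.povmRate σ ε E = QChiSq.divergenceRate σ ε) ∧
        ∀ (r : ℕ) (E : Fin r → Matrix (Fin D) (Fin D) ℂ), QChiSq.IsPOVM E →
          ∃ ρ ∈ QChiSq.alternatives σ ε,
            QChiSq.chiSq (QChiSq.born E σ) (QChiSq.born E ρ) / ENNReal.ofReal (ε ^ 2) =
              QChiSq.povmRate σ ε E) ∧
      -- the same for the rate written with directions, pure states included
      (QChiSq.dirDivergenceRate σ = ENNReal.ofReal ξ ∧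
        (∃ (r : ℕ) (E : Fin r → Matrix (Fin D) (Fin D) ℂ), QChiSq.IsPOVM E ∧
          QChiSq.povmDirRate σ E = QChiSq.dirDivergenceRate σ) ∧
        ∀ (r : ℕ) (E : Fin r → Matrix (Fin D) (Fin D) ℂ), QChiSq.IsPOVM E →
          ∃ X ∈ QChiSq.directions D, QChiSq.chiForm σ E X = QChiSq.povmDirRate σ E) ∧
      -- a pure state as a limit of states of full rank
      (QChiSq.IsPure σ → ∀ η : ℝ, 0 < η → ∃ δ : ℝ, 0 < δ ∧
        ∀ σ' : Matrix (Fin D) (Fin D) ℂ, QChiSq.IsState σ' → σ'.PosDef →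
          QChiSq.frobNorm (σ' - σ) < δ → ∀ ε : ℝ, QChiSq.IsSmallRadius σ' ε →
            ENNReal.ofReal (1 - η) ≤ QChiSq.divergenceRate σ' ε ∧
              QChiSq.divergenceRate σ' ε ≤ 1) ∧
      -- the bounds and the cases of equality
      2 / 3 ≤ ξ ∧ ξ ≤ 1 ∧
      (ξ = 1 ↔ QChiSq.IsPure σ) ∧
      (ξ = 2 / 3 ↔ ∃ i j : Fin D, i ≠ j ∧ lam i = 1 / 2 ∧ lam j = 1 / 2 ∧
        ∀ k : Fin D, k ≠ i → k ≠ j → lam k = 0) ∧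
      -- an optimal measurement
      (¬ QChiSq.IsPure σ →
        (∃ (m : ℕ) (θ : Fin m → Fin D → ℝ) (c : ℝ), QChiSq.IsPhaseInvariant b θ ∧
          ∑ j, (c : ℂ) • QChiSq.proj (QChiSq.phaseState b (θ j)) =
            (ξ : ℂ) • (1 : Matrix (Fin D) (Fin D) ℂ)) ∧
        ∀ (m : ℕ) (θ : Fin m → Fin D → ℝ) (c : ℝ), QChiSq.IsPhaseInvariant b θ →
          ∑ j, (c : ℂ) • QChiSq.proj (QChiSq.phaseState b (θ j)) =
            (ξ : ℂ) • (1 : Matrix (Fin D) (Fin D) ℂ) →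
          QChiSq.IsPOVM (QChiSq.phasePOVM b ξ c θ) ∧
          QChiSq.IsInfoComplete (QChiSq.phasePOVM b ξ c θ) ∧
          QChiSq.povmDirRate σ (QChiSq.phasePOVM b ξ c θ) = QChiSq.dirDivergenceRate σ ∧
          ∀ ε : ℝ, QChiSq.IsSmallRadius σ ε →
            QChiSq.povmRate σ ε (QChiSq.phasePOVM b ξ c θ) = QChiSq.divergenceRate σ ε) := by

  have hD0 : D ≠ 0 := by omega
  have hd := QChiSq.rot_eigenbasis b hb
  obtain ⟨hnn, hlam⟩ := QChiSq.eigenvalues_of_isState hσ hd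
  obtain ⟨μ, hμ, hR⟩ := QChiSq.exists_isGreatest_eigenvalue_covMatrix (by omega) lam
  obtain ⟨hμ0, hμ1⟩ := QChiSq.largest_eigenvalue_eq_zero_iff hnn hlam hμ.1 hR
  have hpure : QChiSq.IsPure σ ↔ μ = 0 := (QChiSq.isPure_iff hnn hlam hd).trans hμ1.symm
  have hhalf := QChiSq.eigenvalue_covMatrix_le_half hnn hlam hμ.1
  obtain ⟨m₀, θ₀, hm₀, hmom₀⟩ := QChiSq.exists_hasPhaseMoments D
  have hframe := QChiSq.sum_proj_of_hasPhaseMoments (b := b) hD0 hm₀.ne' hmom₀ (1 / (1 + μ))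
  have hpos : ¬ QChiSq.IsPure σ → 0 < μ := fun h =>
    lt_of_le_of_ne hμ0 fun h0 => h (hpure.2 h0.symm)
  have hmin := fun (r : ℕ) (E : Fin r → Matrix (Fin D) (Fin D) ℂ) (_ : QChiSq.IsPOVM E) =>
    QChiSq.exists_eq_povmDirRate (QChiSq.directions_nonempty hD) σ E
  refine ⟨μ, 1 / (1 + μ), hμ, rfl, ?_, ?_, ?_, ?_, ?_, ?_, ?_, ?_⟩
  · intro hnp ε hε
    have hμpos := hpos hnp
    obtain ⟨-, -, -, h⟩ := QChiSq.rates_of_pos hD0 hσ hb hμpos hμ.1 hR hmom₀ hframe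
    refine ⟨(h ε hε).1, (h ε hε).2.2, fun r E hE => QChiSq.exists_eq_povmRate ?_ E⟩
    -- The direction of the upper bound also shows that there are alternatives at distance `ε`, so
    -- the infimum is not over the empty set.
    obtain ⟨X, hX, -, hst⟩ :=
      QChiSq.exists_direction_of_eigenbasis hE hb hnn hlam hμpos hμ.1
    exact ⟨_, (QChiSq.povmRate_le (E := E) hX.2.2 hε.1 (hst ε hε)).1⟩
  · by_cases hp : QChiSq.IsPure σ
    · obtain ⟨k, hk⟩ := (QChiSq.isPure_iff hnn hlam hd).1 hp
      rw [QChiSq.eq_single_of_apply_eq_one hnn hlam hk] at hd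
      obtain ⟨h1, h2⟩ := QChiSq.dirRate_of_single hD hd
      refine ⟨?_, h2, hmin⟩
      rw [h1, hpure.1 hp]
      simp
    · obtain ⟨-, -, h, -⟩ := QChiSq.rates_of_pos hD0 hσ hb (hpos hp) hμ.1 hR hmom₀ hframe
      exact ⟨h.1, h.2.2, hmin⟩
  · intro hp η hη
    -- From `‖σ'‖ ≥ 1 - η/4` one gets `2 (1 - ‖σ'‖²) ≤ η`, whatever `ε` is.
    refine ⟨η / 4, by positivity, fun σ' hσ' hσ'pos hclose ε hε => ?_⟩
    obtain ⟨h1, h2⟩ := QChiSq.divergenceRate_of_posDef hD hσ' hσ'pos hε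
    refine ⟨le_trans (ENNReal.ofReal_le_ofReal ?_) h1, h2⟩
    have h3 := QChiSq.frobNorm_le_add σ σ'
    rw [QChiSq.frobNorm_of_isPure hp] at h3
    nlinarith [sq_nonneg (QChiSq.frobNorm σ' - 1)]
  · rw [div_le_div_iff₀ (by norm_num) (by positivity)]
    linarith
  · rw [div_le_one (by positivity)]
    linarith
  · rw [hpure, div_eq_one_iff_eq (by positivity)]
    constructor <;> intro h <;> linarith
  · have h1 : 1 / (1 + μ) = 2 / 3 ↔ μ = 1 / 2 := by
      rw [div_eq_div_iff (by positivity) (by norm_num)]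
      constructor <;> intro h <;> linarith
    rw [h1]
    constructor
    · rintro rfl
      exact QChiSq.eigenvalue_covMatrix_eq_half hnn hlam hμ.1
    · rintro ⟨i, j, hij, hi, hj, hk⟩
      exact le_antisymm hhalf (hμ.2 (QChiSq.hasEigenvalue_covMatrix_half hij hi hj hk))
  · intro hnp
    have hμpos := hpos hnp
    refine ⟨⟨m₀, θ₀, _, QChiSq.isPhaseInvariant_of_hasPhaseMoments b hmom₀, hframe⟩, ?_⟩
    intro m θ c hinv hc
    have hmom := QChiSq.hasPhaseMoments_of_isPhaseInvariant b hD0 hinv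
    obtain ⟨h1, h2, h3, h4⟩ := QChiSq.rates_of_pos hD0 hσ hb hμpos hμ.1 hR hmom hc
    exact ⟨h1, h2, h3.2.1.trans h3.1.symm, fun ε hε => (h4 ε hε).2.1.trans (h4 ε hε).1.symm⟩
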